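/- Let $k$ be an algebraically closed field and let $A=[\mathbf a_1\ \cdots\ \mathbf a_n]$ be a $d\times n$ integer matrix of rank $d$ such that the lattice $\mathcal L=\{\mathbf u\in\mathbb Z^n : A\mathbf u=\mathbf 0\}$ satisfies $\mathcal L\cap\mathbb N^n=\{\mathbf 0\}$. A circuit is a non-zero primitive vector $\mathbf c\in\mathcal L$ such that no non-zero $\mathbf v\in\mathcal L$ satisfies $\operatorname{supp}(\mathbf v)\subsetneq\operatorname{supp}(\mathbf c)$. In $k[\mathbf x]=k[x_1,\dots,x_n]$, graded by $\deg x_i=\mathbf a_i$, let $$I_{\mathcal C}=\langle \mathbf x^{\mathbf c^+}-\mathbf x^{\mathbf c^-} : \mathbf c \text{ a circuit}\rangle\subseteq I_A=\langle \mathbf x^{\mathbf u^+}-\mathbf x^{\mathbf u^-} : \mathbf u\in\mathcal L\rangle$$ be the circuit ideal and the toric ideal. Let $\mathbb NA=\{A\mathbf u:\mathbf u\in\mathbb N^n\}$, $\pi^{-1}(\mathbf b)=\{\mathbf u\in\mathbb N^n : A\mathbf u=\mathbf b\}$, and $\operatorname{cone}(A)=\{\sum_i\lambda_i\mathbf a_i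 : \lambda_i\ge 0\}\subseteq\mathbb R^d$. For a weight vector $\omega\in\mathbb R^n$ let $\mathrm{in}_\omega(f)$ be the sum of the terms of $f$ of maximal $\omega$-weight, and $\mathrm{in}_\omega(I)=\langle \mathrm{in}_\omega(f): f\in I\rangle$; call $\omega$ generic if $\mathrm{in}_\omega(I_A)$ and $\mathrm{in}_\omega(I_{\mathcal C})$ are monomial ideals. For a set $G$ of binomials $\mathbf x^{\mathbf p}-\mathbf x^{\mathbf q}$ ($\mathbf p\ne\mathbf q$) generating $I_{\mathcal C}$, let $\mathcal F^{\mathcal C}(\mathbf b)$ be the graph on $\pi^{-1}(\mathbf b)$ in which $\mathbf u\neq\mathbf v$ are adjacent if $\mathbf x^{\mathbf u}-\mathbf x^{\mathbf v}$ is, up to sign, a monomial multiple of an element of $G$. For generic $\omega$ let $\mathcal F^{\mathcal C}_\omega(\mathbf b)$ be the directed graph on $\pi^{-1}(\mathbf b)$ with an arrow $\mathbf u\to\mathbf v$ if $\mathbf x^{\mathbf u}-\mathbf x^{\mathbf v}=\mathbf x^{\mathbf w}(\mathbf x^{\mathbf p}-\mathbf x^{\mathbf q})$ for a monomial $\mathbf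 x^{\mathbf w}$ and an element $\mathbf x^{\mathbf p}-\mathbf x^{\mathbf q}$, with initial term $\mathbf x^{\mathbf p}$, of the reduced Gröbner basis of $I_{\mathcal C}$ with respect to $\omega$; it is called connected if its underlying undirected graph is. For a monomial ideal $M$, a pair $(\mathbf x^{\mathbf u},\sigma)$ with $\mathbf u\in\mathbb N^n$, $\sigma\subseteq\{1,\dots,n\}$ is admissible if $\operatorname{supp}(\mathbf u)\cap\sigma=\emptyset$ and no monomial $\mathbf x^{\mathbf u+\mathbf m}$ with $\operatorname{supp}(\mathbf m)\subseteq\sigma$ lies in $M$; it is a standard pair if in addition there is no other admissible pair $(\mathbf x^{\mathbf v},\tau)$ with $\mathbf v\le\mathbf u$ and $\operatorname{supp}(\mathbf u-\mathbf v)\cup\sigma\subseteq\tau$. For generic $\omega$, a circuit-specific standard pair (CSP) is a standard pair of $\mathrm{in}_\omega(I_{\mathcal C})$ that is not a standard pair of $\mathrm{in}_\omega(I_A)$. **Theorem.** 1. There is a real number $R$ such that for every $\mathbf b\in\mathbb NA$ at Euclidean distance at least $R$ from every point of the boundary of $\operatorname{cone}(A)$: the Hilbert function value $\dim_k (k[\mathbf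 x]/I_{\mathcal C})_{\mathbf b}$ equals $1$; the graph $\mathcal F^{\mathcal C}(\mathbf b)$ is connected for every generating set $G$ of $I_{\mathcal C}$ as above; and the directed graph $\mathcal F^{\mathcal C}_\omega(\mathbf b)$ is connected for every generic $\omega$. 2. For every generic $\omega$ and every CSP $(\mathbf x^{\mathbf u},\sigma)$ of $\mathrm{in}_\omega(I_{\mathcal C})$, the set $\{\mathbf a_i : i\in\sigma\}$ is contained in a facet of $\operatorname{cone}(A)$. -/

import Mathlib

noncomputable section

namespace CircuitIdeal

open MvPolynomial

variable {d n : ℕ}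

/-! ### Vector configurations

A configuration `a₁, …, aₙ` in `ℤ^d` is given by the matrix `A` with columns `a₁, …, aₙ`. -/

/-- The map `π : ℕⁿ → ℤ^d`, `u ↦ A u = ∑ uᵢ aᵢ`; it is the weight homomorphism of the grading
`deg xᵢ = aᵢ`. -/
def degMap (A : Matrix (Fin d) (Fin n) ℤ) : (Fin n →₀ ℕ) →+ (Fin d → ℤ) :=
  Finsupp.weight A.col

/-- The semigroup `ℕA = {A u : u ∈ ℕⁿ}`. -/
def semigroup (A : Matrix (Fin d) (Fin n) ℤ) : AddSubmonoid (Fin d → ℤ) :=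
  AddMonoidHom.mrange (degMap A)

/-- The lattice `{u ∈ ℤⁿ : A u = 0}`. -/
def lattice (A : Matrix (Fin d) (Fin n) ℤ) : Submodule ℤ (Fin n → ℤ) :=
  LinearMap.ker A.mulVecLin

/-- The inclusion of `ℤ^d` in Euclidean `d`-space. -/
def toEuclidean (b : Fin d → ℤ) : EuclideanSpace ℝ (Fin d) :=
  WithLp.toLp 2 (fun i => (b i : ℝ))

/-- `cone(A)`: the nonnegative real combinations of the columns of `A`. -/
def cone (A : Matrix (Fin d) (Fin n) ℤ) : Set (EuclideanSpace ℝ (Fin d)) :=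
  {x | ∃ c : Fin n → ℝ, (∀ i, 0 ≤ c i) ∧ x = ∑ i, c i • toEuclidean (A.col i)}

/-- A facet of `cone(A)` in `ℝ^d`: a face (the zero set in the cone of a linear form that is
nonnegative on the cone) of dimension `d - 1`. -/
def IsFacet (A : Matrix (Fin d) (Fin n) ℤ) (F : Set (EuclideanSpace ℝ (Fin d))) : Prop :=
  (∃ c : EuclideanSpace ℝ (Fin d), (∀ x ∈ cone A, 0 ≤ inner ℝ c x) ∧
    F = {x ∈ cone A | inner ℝ c x = 0}) ∧
  Module.finrank ℝ (Submodule.span ℝ F) + 1 = d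

/-! ### Circuits, circuit ideal, toric ideal -/

/-- The positive part `u⁺`, as an exponent vector. -/
def pos (u : Fin n → ℤ) : Fin n →₀ ℕ := Finsupp.equivFunOnFinite.symm fun i => (u i).toNat

/-- The negative part `u⁻`, as an exponent vector. -/
def neg (u : Fin n → ℤ) : Fin n →₀ ℕ := Finsupp.equivFunOnFinite.symm fun i => (-u i).toNat

/-- A circuit: a nonzero primitive vector of the lattice whose support is minimal among the supports
of the nonzero vectors of the lattice. -/
def IsCircuit (A : Matrix (Fin d) (Fin n) ℤ) (c : Fin n → ℤ) : Prop :=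
  c ∈ lattice A ∧ c ≠ 0 ∧ Finset.univ.gcd c = 1 ∧
    ¬ ∃ v ∈ lattice A, v ≠ 0 ∧ Function.support v ⊂ Function.support c

variable (k : Type*) [Field k]

/-- The binomial `x^p - x^q`. -/
def binomial (p q : Fin n →₀ ℕ) : MvPolynomial (Fin n) k := monomial p 1 - monomial q 1

/-- The circuit ideal. -/
def circuitIdeal (A : Matrix (Fin d) (Fin n) ℤ) : Ideal (MvPolynomial (Fin n) k) :=
  Ideal.span {f | ∃ c, IsCircuit A c ∧ f = binomial k (pos c) (neg c)}

/-- The toric ideal. -/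
def toricIdeal (A : Matrix (Fin d) (Fin n) ℤ) : Ideal (MvPolynomial (Fin n) k) :=
  Ideal.span {f | ∃ u ∈ lattice A, f = binomial k (pos u) (neg u)}

variable {k}

/-- The `A`-graded Hilbert function of `k[x]/I` (for an `A`-homogeneous ideal `I`): the dimension of
the degree `b` part of `k[x]/I`, which is the image of the degree `b` part of `k[x]`. -/
def hilbertFunction (A : Matrix (Fin d) (Fin n) ℤ) (I : Ideal (MvPolynomial (Fin n) k))
    (b : Fin d → ℤ) : ℕ :=
  Module.finrank k
    ((weightedHomogeneousSubmodule k A.col b).map (Ideal.Quotient.mkₐ k I).toLinearMap)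

/-! ### Initial ideals with respect to a real weight vector -/

/-- The weight `ω · u`. -/
def weight (ω : Fin n → ℝ) (u : Fin n →₀ ℕ) : ℝ := ∑ i, ω i * (u i : ℝ)

open Classical in
/-- `in_ω(f)`: the sum of the terms of `f` of maximal `ω`-weight. -/
def initialForm (ω : Fin n → ℝ) (f : MvPolynomial (Fin n) k) : MvPolynomial (Fin n) k :=
  ∑ u ∈ f.support with ∀ v ∈ f.support, weight ω v ≤ weight ω u, monomial u (coeff u f)

/-- `in_ω(I)`: the ideal generated by the initial forms of all elements of `I`. -/
def initialIdeal (ω : Fin n → ℝ) (I : Ideal (MvPolynomial (Fin n) k)) :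
    Ideal (MvPolynomial (Fin n) k) :=
  Ideal.span (initialForm ω '' I)

/-- An ideal generated by monomials. -/
def IsMonomialIdeal (M : Ideal (MvPolynomial (Fin n) k)) : Prop :=
  ∃ S : Set (Fin n →₀ ℕ), M = Ideal.span ((fun u => monomial u (1 : k)) '' S)

variable (k) in
/-- A weight vector is generic if the initial ideals of both the toric ideal and the circuit ideal
are monomial ideals. -/
def IsGeneric (A : Matrix (Fin d) (Fin n) ℤ) (ω : Fin n → ℝ) : Prop :=
  IsMonomialIdeal (initialIdeal ω (toricIdeal k A)) ∧
    IsMonomialIdeal (initialIdeal ω (circuitIdeal k A))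

/-- The reduced Gröbner basis of `I` with respect to `ω` (when `in_ω(I)` is a monomial ideal): the
elements `g` of `I` whose initial form is a minimal monomial generator of `in_ω(I)`, with
coefficient one, and all of whose other monomials lie outside `in_ω(I)`. -/
def reducedGroebnerBasis (ω : Fin n → ℝ) (I : Ideal (MvPolynomial (Fin n) k)) :
    Set (MvPolynomial (Fin n) k) :=
  {g | g ∈ I ∧ ∃ m : Fin n →₀ ℕ,
    Minimal (fun e => monomial e (1 : k) ∈ initialIdeal ω I) m ∧
    initialForm ω g = monomial m 1 ∧
    ∀ e ∈ g.support, e ≠ m → monomial e (1 : k) ∉ initialIdeal ω I}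

/-! ### Fiber graphs -/

/-- `π⁻¹(b)`, the vertex set of the fiber graphs. -/
def fiber (A : Matrix (Fin d) (Fin n) ℤ) (b : Fin d → ℤ) : Set (Fin n →₀ ℕ) :=
  {u | degMap A u = b}

/-- `G` is a generating set of `I` consisting of binomials `x^p - x^q`, `p ≠ q`. -/
def IsBinomialGeneratingSet (G : Set (MvPolynomial (Fin n) k))
    (I : Ideal (MvPolynomial (Fin n) k)) : Prop :=
  (∀ g ∈ G, ∃ p q : Fin n →₀ ℕ, p ≠ q ∧ g = binomial k p q) ∧ Ideal.span G = I

/-- The fiber graph on `π⁻¹(b)` of a set `G` of binomials: `u` and `v` are adjacent if `x^u - x^v` is,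
up to sign, a monomial multiple of a binomial in `G`. -/
def fiberGraph (A : Matrix (Fin d) (Fin n) ℤ) (G : Set (MvPolynomial (Fin n) k))
    (b : Fin d → ℤ) : SimpleGraph (fiber A b) :=
  SimpleGraph.fromRel fun u v => ∃ g ∈ G, ∃ w : Fin n →₀ ℕ,
    binomial k u.1 v.1 = monomial w 1 * g

/-- The directed fiber graph on `π⁻¹(b)` of the marked reduced Gröbner basis of `I` with respect to
`ω`: there is an arrow from `u` to `v` if `x^u - x^v` is `x^w (x^p - x^q)` for some monomial `x^w` and
some marked binomial `x^p - x^q` in the basis, the first term `x^p` being the initial term. -/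
def fiberDigraph (A : Matrix (Fin d) (Fin n) ℤ) (ω : Fin n → ℝ)
    (I : Ideal (MvPolynomial (Fin n) k)) (b : Fin d → ℤ) : Digraph (fiber A b) where
  Adj u v := ∃ p q w : Fin n →₀ ℕ, binomial k p q ∈ reducedGroebnerBasis ω I ∧
    initialForm ω (binomial k p q) = monomial p 1 ∧ u.1 = w + p ∧ v.1 = w + q

/-! ### Standard pairs -/

/-- `(x^u, σ)` is an admissible pair of the monomial ideal `M`. -/
def IsAdmissiblePair (M : Ideal (MvPolynomial (Fin n) k)) (u : Fin n →₀ ℕ)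
    (σ : Finset (Fin n)) : Prop :=
  Disjoint u.support σ ∧
    ∀ m : Fin n →₀ ℕ, m.support ⊆ σ → monomial (u + m) (1 : k) ∉ M

/-- `(x^u, σ)` is a standard pair of the monomial ideal `M`. -/
def IsStandardPair (M : Ideal (MvPolynomial (Fin n) k)) (u : Fin n →₀ ℕ)
    (σ : Finset (Fin n)) : Prop :=
  IsAdmissiblePair M u σ ∧
    ¬ ∃ (v : Fin n →₀ ℕ) (τ : Finset (Fin n)), (v, τ) ≠ (u, σ) ∧ IsAdmissiblePair M v τ ∧
      v ≤ u ∧ (u - v).support ∪ σ ⊆ τ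

variable (k) in
/-- A circuit-specific standard pair: a standard pair of the initial ideal of the circuit ideal that
is not a standard pair of the initial ideal of the toric ideal. -/
def IsCSP (A : Matrix (Fin d) (Fin n) ℤ) (ω : Fin n → ℝ) (u : Fin n →₀ ℕ)
    (σ : Finset (Fin n)) : Prop :=
  IsStandardPair (initialIdeal ω (circuitIdeal k A)) u σ ∧
    ¬ IsStandardPair (initialIdeal ω (toricIdeal k A)) u σ

end CircuitIdeal

end

namespace CircuitIdeal

open MvPolynomial

variable {k : Type*} [Field k] {d n : ℕ}

/-! Write `u ~ v` when `x^u - x^v` lies in the circuit ideal `I_C`. Three facts carry the proof.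

(a) The circuits generate the lattice over `ℤ` (`mem_closure_circuits`). Hence `I_C` and the toric
ideal `I_A` agree after inverting all variables, and by Noetherianity one power of `x₁⋯xₙ`
multiplies `I_A` into `I_C` (`exists_forall_cong`).

(b) If some nonnegative combination of the columns in `σ` is interior to the cone, then for each `i
∉ σ` there is a circuit that is negative at `i` and nonpositive off `σ`. Multiplying such circuits
gives a power of `x^σ` congruent to a monomial of full support (`Covers`, `covers_of_mem_interior`).
Inverting `x^σ` therefore already inverts every variable, so a power of `x^σ` multiplies each
element of `I_A` into `I_C`.

(c) If `b` is deep in the cone, the large coordinates of any `u` in the fiber form a set `σ` as in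
(b), since discarding the small coordinates moves `A u` only a bounded distance. So `u ~ u'` with
`u'` large everywhere, and (a) makes all exponents of the fiber congruent. The Hilbert function and
both graph statements follow from this.

For the standard pairs: if the columns in `σ` lie in no facet, their sum is interior and (b)
applies. The initial ideals then have the same admissible pairs `(v, τ)` with `σ ⊆ τ`, hence the
same standard pairs on `σ`. -/

/-! ### Functionals summing coefficients over a set of monomials -/

open Classical in
/-- The linear functional sending a polynomial to the sum of its coefficients at exponents in `S`. -/
noncomputable def coeffSum (S : Set (Fin n →₀ ℕ)) : MvPolynomial (Fin n) k →ₗ[k] k :=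
  (basisMonomials (Fin n) k).constr k fun u => if u ∈ S then 1 else 0

open Classical in
theorem coeffSum_monomial (S : Set (Fin n →₀ ℕ)) (u : Fin n →₀ ℕ) (c : k) :
    coeffSum S (monomial u c) = if u ∈ S then c else 0 := by
  have h : monomial u c = c • basisMonomials (Fin n) k u := by
    simp [smul_monomial]
  rw [h, map_smul, coeffSum, Module.Basis.constr_basis]
  split_ifs <;> simp

open Classical in
theorem coeffSum_apply (S : Set (Fin n →₀ ℕ)) (f : MvPolynomial (Fin n) k) :
    coeffSum S f = ∑ u ∈ f.support, if u ∈ S then coeff u f else 0 := by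
  conv_lhs => rw [← support_sum_monomial_coeff f, map_sum]
  simp [coeffSum_monomial]

theorem monomial_mul_binomial (w p q : Fin n →₀ ℕ) :
    monomial w 1 * binomial k p q = binomial k (w + p) (w + q) := by
  simp [binomial, mul_sub, monomial_mul]

/-- The two terms of a monomial multiple of a generator lie both in `S` or both outside it, so their
coefficients cancel. -/
theorem coeffSum_eq_zero_of_mem_span {G : Set (MvPolynomial (Fin n) k)} {S : Set (Fin n →₀ ℕ)}
    (hG : ∀ g ∈ G, ∃ p q, g = binomial k p q ∧ ∀ w, w + p ∈ S ↔ w + q ∈ S)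
    {f : MvPolynomial (Fin n) k} (hf : f ∈ Ideal.span G) : coeffSum S f = 0 := by
  suffices h : ∀ g, coeffSum S (g * f) = 0 by simpa using h 1
  induction hf using Submodule.span_induction with
  | mem x hx =>
    intro g
    obtain ⟨p, q, rfl, hpq⟩ := hG x hx
    induction g using MvPolynomial.induction_on' with
    | monomial u a =>
      have : monomial u a * binomial k p q = a • binomial k (u + p) (u + q) := by
        rw [← monomial_mul_binomial, ← smul_mul_assoc, smul_monomial]; simp
      rw [this, map_smul, binomial, map_sub, coeffSum_monomial, coeffSum_monomial]
      by_cases h : u + p ∈ S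
      · rw [if_pos h, if_pos ((hpq u).1 h), sub_self, smul_zero]
      · rw [if_neg h, if_neg fun h' => h ((hpq u).2 h'), sub_self, smul_zero]
    | add p q hp hq => rw [add_mul, map_add, hp, hq, add_zero]
  | zero => simp
  | add x y _ _ hx hy => intro g; rw [mul_add, map_add, hx, hy, add_zero]
  | smul a x _ hx => intro g; rw [smul_eq_mul, ← mul_assoc]; exact hx _

/-- This turns ideal membership into a combinatorial invariant; it is used with `S` a degree fiber
and with `S` a connected component of a fiber graph. -/
theorem mem_iff_of_binomial_mem_span {G : Set (MvPolynomial (Fin n) k)} {S : Set (Fin n →₀ ℕ)}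
    (hG : ∀ g ∈ G, ∃ p q, g = binomial k p q ∧ ∀ w, w + p ∈ S ↔ w + q ∈ S)
    {u v : Fin n →₀ ℕ} (h : binomial k u v ∈ Ideal.span G) : u ∈ S ↔ v ∈ S := by
  classical
  have := coeffSum_eq_zero_of_mem_span hG h
  rw [binomial, map_sub, coeffSum_monomial, coeffSum_monomial] at this
  by_cases hu : u ∈ S <;> by_cases hv : v ∈ S <;> simp_all

/-! ### Congruence of exponents modulo an ideal -/

section Cong

variable {I : Ideal (MvPolynomial (Fin n) k)} {u v w u' v' : Fin n →₀ ℕ}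

theorem cong_refl (I : Ideal (MvPolynomial (Fin n) k)) (u : Fin n →₀ ℕ) : binomial k u u ∈ I := by
  simp [binomial]

theorem cong_symm (h : binomial k u v ∈ I) : binomial k v u ∈ I := by
  have := I.neg_mem h
  rwa [binomial, neg_sub] at this

theorem cong_trans (h : binomial k u v ∈ I) (h' : binomial k v w ∈ I) : binomial k u w ∈ I := by
  have := I.add_mem h h'
  rwa [binomial, binomial, sub_add_sub_cancel] at this

theorem cong_add_left (w : Fin n →₀ ℕ) (h : binomial k u v ∈ I) :
    binomial k (w + u) (w + v) ∈ I := by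
  rw [← monomial_mul_binomial]; exact I.mul_mem_left _ h

theorem cong_add_right (w : Fin n →₀ ℕ) (h : binomial k u v ∈ I) :
    binomial k (u + w) (v + w) ∈ I := by
  rw [add_comm u, add_comm v]; exact cong_add_left w h

theorem cong_add (h : binomial k u v ∈ I) (h' : binomial k u' v' ∈ I) :
    binomial k (u + u') (v + v') ∈ I :=
  cong_trans (cong_add_right _ h) (cong_add_left _ h')

theorem cong_nsmul (N : ℕ) (h : binomial k u v ∈ I) : binomial k (N • u) (N • v) ∈ I := by
  induction N with
  | zero => simpa using cong_refl I 0
  | succ N ih => rw [succ_nsmul, succ_nsmul]; exact cong_add ih h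

theorem cong_sum {ι : Type*} (s : Finset ι) (f g : ι → Fin n →₀ ℕ)
    (h : ∀ i ∈ s, binomial k (f i) (g i) ∈ I) :
    binomial k (∑ i ∈ s, f i) (∑ i ∈ s, g i) ∈ I := by
  classical
  induction s using Finset.induction_on with
  | empty => simpa using cong_refl I 0
  | insert a s ha ih =>
    rw [Finset.sum_insert ha, Finset.sum_insert ha]
    exact cong_add (h _ (by simp)) (ih fun i hi => h i (by simp [hi]))

theorem cong_congr (h : binomial k u v ∈ I) (h' : binomial k u' v' ∈ I) :
    binomial k u u' ∈ I ↔ binomial k v v' ∈ I :=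
  ⟨fun H => cong_trans (cong_trans (cong_symm h) H) h',
    fun H => cong_trans (cong_trans h H) (cong_symm h')⟩

end Cong

/-! ### The degree map and the toric ideal -/

variable {A : Matrix (Fin d) (Fin n) ℤ}

theorem degMap_apply (A : Matrix (Fin d) (Fin n) ℤ) (u : Fin n →₀ ℕ) :
    degMap A u = A.mulVec fun i => (u i : ℤ) := by
  ext j
  rw [degMap, Finsupp.weight_apply, Finsupp.sum_fintype _ _ (by simp)]
  simp [Matrix.mulVec, dotProduct, mul_comm]

theorem mem_lattice {z : Fin n → ℤ} : z ∈ lattice A ↔ A.mulVec z = 0 := by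
  simp [lattice]

theorem degMap_eq_iff {u v : Fin n →₀ ℕ} :
    degMap A u = degMap A v ↔ (fun i => (u i : ℤ) - v i) ∈ lattice A := by
  rw [mem_lattice, degMap_apply, degMap_apply, ← sub_eq_zero, ← Matrix.mulVec_sub]
  rfl

@[simp] theorem pos_apply (z : Fin n → ℤ) (i : Fin n) : pos z i = (z i).toNat := rfl
@[simp] theorem neg_apply (z : Fin n → ℤ) (i : Fin n) : neg z i = (-z i).toNat := rfl

theorem degMap_pos_eq_neg {z : Fin n → ℤ} (hz : z ∈ lattice A) :
    degMap A (pos z) = degMap A (neg z) := by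
  rw [degMap_eq_iff]
  convert hz using 1
  ext i
  simp only [pos_apply, neg_apply]
  omega

/-- Two exponents differ by `z` exactly as `pos z` and `neg z` do, up to a common summand. -/
theorem exists_eq_add_pos_neg (u v : Fin n →₀ ℕ) :
    ∃ w, u = w + pos (fun i => (u i : ℤ) - v i) ∧ v = w + neg (fun i => (u i : ℤ) - v i) := by
  refine ⟨Finsupp.equivFunOnFinite.symm fun i => min (u i) (v i), ?_, ?_⟩ <;>
  · ext i
    simp
    omega

theorem binomial_mem_toricIdeal_iff {u v : Fin n →₀ ℕ} :
    binomial k u v ∈ toricIdeal k A ↔ degMap A u = degMap A v := by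
  constructor
  · intro h
    have := mem_iff_of_binomial_mem_span (S := {w | degMap A w = degMap A v}) ?_ h
    · simpa using this
    · rintro _ ⟨z, hz, rfl⟩
      refine ⟨_, _, rfl, fun w => ?_⟩
      simp [degMap_pos_eq_neg hz]
  · intro h
    obtain ⟨w, hu, hv⟩ := exists_eq_add_pos_neg u v
    have : binomial k (pos fun i => (u i : ℤ) - v i) (neg fun i => (u i : ℤ) - v i) ∈
        toricIdeal k A := Ideal.subset_span ⟨_, degMap_eq_iff.1 h, rfl⟩
    have := cong_add_left w this
    rwa [← hu, ← hv] at this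

theorem circuitIdeal_le_toricIdeal : circuitIdeal k A ≤ toricIdeal k A := by
  refine Ideal.span_mono ?_
  rintro _ ⟨c, hc, rfl⟩
  exact ⟨c, hc.1, rfl⟩

theorem degMap_eq_of_mem_circuitIdeal {u v : Fin n →₀ ℕ} (h : binomial k u v ∈ circuitIdeal k A) :
    degMap A u = degMap A v :=
  binomial_mem_toricIdeal_iff.1 (circuitIdeal_le_toricIdeal h)

theorem circuit_cong {c : Fin n → ℤ} (hc : IsCircuit A c) :
    binomial k (pos c) (neg c) ∈ circuitIdeal k A :=
  Ideal.subset_span ⟨c, hc, rfl⟩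

theorem coeffSum_eq_zero_of_mem_circuitIdeal {S : Set (Fin n →₀ ℕ)}
    (hS : ∀ u v, binomial k u v ∈ circuitIdeal k A → (u ∈ S ↔ v ∈ S))
    {f : MvPolynomial (Fin n) k} (hf : f ∈ circuitIdeal k A) : coeffSum S f = 0 := by
  refine coeffSum_eq_zero_of_mem_span ?_ hf
  rintro _ ⟨c, hc, rfl⟩
  exact ⟨_, _, rfl, fun w => hS _ _ (cong_add_left w (circuit_cong hc))⟩

theorem monomial_notMem_circuitIdeal (u : Fin n →₀ ℕ) :
    monomial u (1 : k) ∉ circuitIdeal k A := fun h => by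
  have := coeffSum_eq_zero_of_mem_circuitIdeal (S := Set.univ) (by simp) h
  simp [coeffSum_monomial] at this

/-! ### Multiplying the toric ideal into the circuit ideal -/

/-- The indicator exponent of `σ`. -/
noncomputable def ind (σ : Finset (Fin n)) : Fin n →₀ ℕ :=
  Finsupp.equivFunOnFinite.symm fun i => if i ∈ σ then 1 else 0

@[simp] theorem ind_apply (σ : Finset (Fin n)) (i : Fin n) :
    ind σ i = if i ∈ σ then 1 else 0 := rfl

/-- Write `u - v` as a sum of signed circuits and walk between the two exponents one circuit at a
time. The walk may leave `ℕⁿ`; a translation by a multiple of the all-ones vector brings it back. -/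
theorem exists_cong_of_mem_closure
    (hgen : ∀ z ∈ lattice A, z ∈ AddSubgroup.closure {c | IsCircuit A c})
    {u v : Fin n →₀ ℕ} (h : degMap A u = degMap A v) :
    ∃ N : ℕ, binomial k (N • ind Finset.univ + u) (N • ind Finset.univ + v) ∈ circuitIdeal k A := by
  have key : ∀ z ∈ AddSubgroup.closure {c | IsCircuit A c}, ∀ u v : Fin n →₀ ℕ,
      (∀ i, (u i : ℤ) - v i = z i) →
      ∃ N : ℕ, binomial k (N • ind Finset.univ + u) (N • ind Finset.univ + v) ∈
        circuitIdeal k A := by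
    intro z hz
    induction hz using AddSubgroup.closure_induction with
    | mem c hc =>
      intro u v huv
      obtain ⟨w, hu, hv⟩ := exists_eq_add_pos_neg u v
      refine ⟨0, ?_⟩
      rw [funext huv] at hu hv
      rw [hu, hv, ← add_assoc, ← add_assoc]
      exact cong_add_left _ (circuit_cong hc)
    | zero =>
      intro u v huv
      have : u = v := by ext i; have := huv i; simp at this; omega
      exact ⟨0, this ▸ cong_refl _ _⟩
    | add z₁ z₂ _ _ h₁ h₂ =>
      intro u v huv
      -- The intermediate point `v + z₂` may have negative entries; `K` shifts it into `ℕⁿ`, giving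
      -- the midpoint `w`.
      obtain ⟨K, hK⟩ : ∃ K : ℕ, ∀ i, 0 ≤ (v i : ℤ) + z₂ i + K := by
        refine ⟨∑ i, (z₂ i).natAbs, fun i => ?_⟩
        have := Finset.single_le_sum (f := fun i => (z₂ i).natAbs) (by simp) (Finset.mem_univ i)
        omega
      set w : Fin n →₀ ℕ := Finsupp.equivFunOnFinite.symm fun i => ((v i : ℤ) + z₂ i + K).toNat
      have hw : ∀ i, (w i : ℤ) = (v i : ℤ) + z₂ i + K := fun i => by
        simp [w, hK i]
      obtain ⟨N₁, hN₁⟩ := h₁ (K • ind Finset.univ + u) w fun i => by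
        have := huv i
        simp at this ⊢
        rw [hw]; linarith
      obtain ⟨N₂, hN₂⟩ := h₂ w (K • ind Finset.univ + v) fun i => by
        simp
        rw [hw]; ring
      refine ⟨N₁ + N₂ + K, ?_⟩
      have := cong_trans (cong_add_left (N₂ • ind Finset.univ) hN₁)
        (by simpa only [add_left_comm] using cong_add_left (N₁ • ind Finset.univ) hN₂)
      convert this using 2
      · simp only [add_smul]; abel_nf
      · simp only [add_smul]; abel_nf
    | neg z _ h =>
      intro u v huv
      obtain ⟨N, hN⟩ := h v u fun i => by have := huv i; simp at this; linarith
      exact ⟨N, cong_symm hN⟩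
  exact key _ (hgen _ (degMap_eq_iff.1 h)) u v fun i => rfl

variable (k) in
/-- Every variable becomes invertible once the circuit ideal is localized at the variables
in `σ`: a power of `x^σ` is congruent to a monomial involving all variables. -/
def Covers (A : Matrix (Fin d) (Fin n) ℤ) (σ : Finset (Fin n)) : Prop :=
  ∃ (M : ℕ) (p : Fin n →₀ ℕ), (∀ i, 1 ≤ p i) ∧ binomial k (M • ind σ) p ∈ circuitIdeal k A

theorem covers_univ : Covers k A Finset.univ :=
  ⟨1, ind Finset.univ, by simp, by simpa using cong_refl _ _⟩

/-- The `N`-th power of `x^(Mσ) ~ x^p` has `N • p ≥ N` in every coordinate, which absorbs the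
all-variables shift of `exists_cong_of_mem_closure`. -/
theorem Covers.exists_cong
    (hgen : ∀ z ∈ lattice A, z ∈ AddSubgroup.closure {c | IsCircuit A c})
    {σ : Finset (Fin n)} (hσ : Covers k A σ) {u v : Fin n →₀ ℕ} (h : degMap A u = degMap A v) :
    ∃ N : ℕ, binomial k (N • ind σ + u) (N • ind σ + v) ∈ circuitIdeal k A := by
  obtain ⟨M, p, hp, hM⟩ := hσ
  obtain ⟨N, hN⟩ := exists_cong_of_mem_closure (k := k) hgen h
  obtain ⟨r, rfl⟩ : ∃ r, p = ind Finset.univ + r :=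
    ⟨p - ind Finset.univ, by ext i; simp; have := hp i; omega⟩
  have key : binomial k (N • (ind Finset.univ + r) + u) (N • (ind Finset.univ + r) + v) ∈
      circuitIdeal k A := by
    convert cong_add_left (N • r) hN using 2 <;>
    · simp only [smul_add]; abel
  refine ⟨N * M, ?_⟩
  rw [mul_smul]
  have := cong_nsmul N hM
  exact (cong_congr (cong_add_right _ this) (cong_add_right _ this)).2 key

/-- If multiplying by powers of `x^s` takes generators of `J` into `I`, so it does with all of `J`. -/
theorem exists_monomial_mul_mem_of_mem_span {s : Fin n →₀ ℕ} {G : Set (MvPolynomial (Fin n) k)}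
    {I : Ideal (MvPolynomial (Fin n) k)} (hG : ∀ g ∈ G, ∃ N : ℕ, monomial (N • s) 1 * g ∈ I)
    {f : MvPolynomial (Fin n) k} (hf : f ∈ Ideal.span G) :
    ∃ N : ℕ, monomial (N • s) 1 * f ∈ I := by
  induction hf using Submodule.span_induction with
  | mem x hx => exact hG x hx
  | zero => exact ⟨0, by simp⟩
  | add x y _ _ hx hy =>
    obtain ⟨N, hN⟩ := hx
    obtain ⟨K, hK⟩ := hy
    refine ⟨N + K, ?_⟩
    have h : monomial ((N + K) • s) (1 : k) = monomial (N • s) 1 * monomial (K • s) 1 := by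
      simp [monomial_mul, add_smul]
    have := I.add_mem (I.mul_mem_left (monomial (K • s) 1) hN)
      (I.mul_mem_left (monomial (N • s) 1) hK)
    rw [h]
    convert this using 1
    ring
  | smul a x _ hx =>
    obtain ⟨N, hN⟩ := hx
    refine ⟨N, ?_⟩
    rw [smul_eq_mul, mul_left_comm]
    exact I.mul_mem_left _ hN

theorem Covers.exists_mul_mem
    (hgen : ∀ z ∈ lattice A, z ∈ AddSubgroup.closure {c | IsCircuit A c})
    {σ : Finset (Fin n)} (hσ : Covers k A σ) {f : MvPolynomial (Fin n) k}
    (hf : f ∈ toricIdeal k A) : ∃ N : ℕ, monomial (N • ind σ) 1 * f ∈ circuitIdeal k A := by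
  refine exists_monomial_mul_mem_of_mem_span ?_ hf
  rintro _ ⟨z, hz, rfl⟩
  obtain ⟨N, hN⟩ := hσ.exists_cong (k := k) hgen (degMap_pos_eq_neg hz)
  exact ⟨N, by rwa [monomial_mul_binomial]⟩

/-- A uniform power of the product of all variables multiplies the toric ideal into the circuit
ideal. -/
theorem exists_forall_cong
    (k : Type*) [Field k] (hgen : ∀ z ∈ lattice A, z ∈ AddSubgroup.closure {c | IsCircuit A c}) :
    ∃ N : ℕ, ∀ u v : Fin n →₀ ℕ, (∀ i, N ≤ u i) → (∀ i, N ≤ v i) → degMap A u = degMap A v →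
      binomial k u v ∈ circuitIdeal k A := by
  classical
  -- Finitely many generators of the toric ideal suffice, so the sum of their individual exponents
  -- is a uniform exponent.
  obtain ⟨S, hS⟩ := IsNoetherian.noetherian (toricIdeal k A)
  have hmem : ∀ f ∈ S, f ∈ toricIdeal k A := fun f hf => hS ▸ Submodule.subset_span hf
  choose! N hN using fun f hf => covers_univ.exists_mul_mem hgen (hmem f hf)
  have hle : toricIdeal k A ≤ Submodule.comap
      (LinearMap.mulLeft (MvPolynomial (Fin n) k)
        (monomial ((∑ f ∈ S, N f) • ind Finset.univ) (1 : k))) (circuitIdeal k A) := by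
    rw [← hS, Submodule.span_le]
    intro f hf
    have hs : N f ≤ ∑ f ∈ S, N f := Finset.single_le_sum (f := N) (by simp) hf
    obtain ⟨r, hr⟩ := Nat.exists_eq_add_of_le' hs
    have h : monomial ((r + N f) • ind (n := n) Finset.univ) (1 : k) =
        monomial (r • ind Finset.univ) 1 * monomial (N f • ind Finset.univ) 1 := by
      simp [monomial_mul, add_smul]
    change monomial ((∑ f ∈ S, N f) • ind Finset.univ) (1 : k) * f ∈ circuitIdeal k A
    rw [hr, h, mul_assoc]
    exact Ideal.mul_mem_left _ _ (hN f hf)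
  refine ⟨∑ f ∈ S, N f, fun u v hu hv huv => ?_⟩
  generalize ∑ f ∈ S, N f = N at *
  obtain ⟨u', rfl⟩ : ∃ u', u = N • ind Finset.univ + u' :=
    ⟨u - N • ind Finset.univ, by ext i; simp; have := hu i; omega⟩
  obtain ⟨v', rfl⟩ : ∃ v', v = N • ind Finset.univ + v' :=
    ⟨v - N • ind Finset.univ, by ext i; simp; have := hv i; omega⟩
  rw [map_add, map_add, add_right_inj] at huv
  rw [← monomial_mul_binomial]
  exact hle (binomial_mem_toricIdeal_iff.2 huv)

/-! ### The circuits generate the lattice -/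

theorem exists_det_submatrix_ne_zero (hrank : (A.map (Int.cast : ℤ → ℝ)).rank = d) :
    ∃ B : Fin d → Fin n, (A.submatrix id B).det ≠ 0 := by
  obtain ⟨κ, a, ha, hspan, hli⟩ := exists_linearIndependent' ℝ (A.map (Int.cast : ℤ → ℝ)).col
  have : Finite κ := Finite.of_injective a ha
  have := Fintype.ofFinite κ
  rw [Matrix.rank_eq_finrank_span_cols, ← hspan, finrank_span_eq_card hli] at hrank
  let e := (Fintype.equivFinOfCardEq hrank).symm
  refine ⟨a ∘ e, fun h => ?_⟩
  have hli' : LinearIndependent ℝ ((A.map (Int.cast : ℤ → ℝ)).submatrix id (a ∘ e)).col :=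
    hli.comp e e.injective
  have h2 := Matrix.linearIndependent_cols_iff_isUnit.1 hli'
  rw [Matrix.isUnit_iff_isUnit_det, isUnit_iff_ne_zero] at h2
  apply h2
  have h3 := (Int.castRingHom ℝ).map_det (A.submatrix id (a ∘ e))
  rw [h, map_zero] at h3
  exact h3.symm

theorem injective_of_det_ne_zero {B : Fin d → Fin n} (hB : (A.submatrix id B).det ≠ 0) :
    Function.Injective B := fun i j hij => by
  by_contra hne
  exact hB (Matrix.det_zero_of_column_eq hne fun l => by simp [hij])

theorem mulVec_eq_submatrix_mulVec {B : Fin d → Fin n} (hB : Function.Injective B)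
    {z : Fin n → ℤ} (hz : ∀ j ∉ Set.range B, z j = 0) :
    A.mulVec z = (A.submatrix id B).mulVec (z ∘ B) := by
  ext i
  simp only [Matrix.mulVec, dotProduct]
  exact (Fintype.sum_of_injective B hB _ _ (fun j hj => by simp [hz j hj]) fun b => rfl).symm

theorem eq_zero_of_mem_lattice {B : Fin d → Fin n} (hB : (A.submatrix id B).det ≠ 0)
    {z : Fin n → ℤ} (hzA : z ∈ lattice A) (hz : ∀ j ∉ Set.range B, z j = 0) : z = 0 := by
  rw [mem_lattice, mulVec_eq_submatrix_mulVec (injective_of_det_ne_zero hB) hz] at hzA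
  have := Matrix.eq_zero_of_mulVec_eq_zero hB hzA
  ext j
  by_cases hj : j ∈ Set.range B
  · obtain ⟨b, rfl⟩ := hj
    exact congrFun this b
  · exact hz j hj

theorem exists_eq_smul_primitive {z : Fin n → ℤ} (hz : z ≠ 0) :
    ∃ (g : ℤ) (c : Fin n → ℤ), 0 < g ∧ z = g • c ∧ Finset.univ.gcd c = 1 := by
  have hne : (Finset.univ : Finset (Fin n)).Nonempty := by
    by_contra h
    rw [Finset.not_nonempty_iff_eq_empty, Finset.univ_eq_empty_iff] at h
    exact hz (Subsingleton.elim _ _)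
  obtain ⟨c, hc, hc1⟩ := Finset.extract_gcd z hne
  refine ⟨Finset.univ.gcd z, c, lt_of_le_of_ne ?_ fun h => hz ?_, ?_, hc1⟩
  · rw [← Finset.normalize_gcd]
    exact Int.nonneg_iff_normalize_eq_self _ |>.1 (normalize_idem _)
  · ext i
    rw [hc i (Finset.mem_univ i), ← h]; simp
  · ext i
    simpa using hc i (Finset.mem_univ i)

/-- A nonzero lattice vector of minimal support is a positive multiple of a circuit. -/
theorem exists_circuit_of_minimal_support {z : Fin n → ℤ} (hz : z ∈ lattice A) (hz0 : z ≠ 0)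
    (hmin : ¬ ∃ v ∈ lattice A, v ≠ 0 ∧ Function.support v ⊂ Function.support z) :
    ∃ (g : ℤ) (c : Fin n → ℤ), 0 < g ∧ z = g • c ∧ IsCircuit A c := by
  obtain ⟨g, c, hg, rfl, hc⟩ := exists_eq_smul_primitive hz0
  refine ⟨g, c, hg, rfl, ?_, ?_, hc, ?_⟩
  · rw [mem_lattice, Matrix.mulVec_smul] at hz
    exact mem_lattice.2 ((smul_eq_zero.1 hz).resolve_left hg.ne')
  · rintro rfl; simp at hz0
  · rwa [Function.support_const_smul_of_ne_zero g c hg.ne'] at hmin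

/-- A lattice vector supported on a basis together with one more index is a multiple of a
circuit. -/
theorem mem_closure_of_support {B : Fin d → Fin n} (hB : (A.submatrix id B).det ≠ 0)
    {z : Fin n → ℤ} (hzA : z ∈ lattice A) (j : Fin n)
    (hz : ∀ i ∉ Set.range B, i ≠ j → z i = 0) :
    z ∈ AddSubgroup.closure {c | IsCircuit A c} := by
  by_cases hz0 : z = 0
  · rw [hz0]; exact zero_mem _
  suffices hmin : ¬ ∃ v ∈ lattice A, v ≠ 0 ∧ Function.support v ⊂ Function.support z by
    obtain ⟨g, c, -, rfl, hc⟩ := exists_circuit_of_minimal_support hzA hz0 hmin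
    have hmem : c ∈ AddSubgroup.closure {c | IsCircuit A c} := AddSubgroup.subset_closure hc
    exact zsmul_mem hmem g
  rintro ⟨v, hvA, hv0, hss⟩
  have hv : ∀ i ∉ Set.range B, i ≠ j → v i = 0 := fun i hi hij => by
    by_contra h
    exact hss.1 h (hz i hi hij)
  have hvj : v j ≠ 0 := fun h => hv0 <| eq_zero_of_mem_lattice hB hvA fun i hi => by
    by_cases hij : i = j
    · rwa [hij]
    · exact hv i hi hij
  -- Eliminating the coordinate `j` leaves a lattice vector supported on the basis, hence zero: `v`
  -- and `z` are proportional and have equal supports.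
  have h0 : z j • v - v j • z = 0 := by
    refine eq_zero_of_mem_lattice hB
      (sub_mem (Submodule.smul_mem _ _ hvA) (Submodule.smul_mem _ _ hzA)) fun i hi => ?_
    by_cases hij : i = j
    · simp [hij, mul_comm]
    · simp [hv i hi hij, hz i hi hij]
  refine hss.2 fun i hi hvi => ?_
  have := congrFun h0 i
  simp only [Pi.sub_apply, Pi.smul_apply, hvi, smul_eq_mul, Pi.zero_apply] at this
  simp at this
  exact this.elim hvj hi

/-- Choose a basis `B` whose determinant has least `p`-adic valuation `e`. Every Cramer determinant
is then divisible by `p^e`, so for `D = det / p^e`, which is prime to `p`, each `D a_j` is an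
integer combination of the columns in `B`. The resulting relations are supported on `B` and one
further index, so they are multiples of circuits. -/
theorem exists_not_dvd_smul_mem_closure (hrank : (A.map (Int.cast : ℤ → ℝ)).rank = d)
    (p : ℕ) [Fact p.Prime] :
    ∃ D : ℤ, ¬ (p : ℤ) ∣ D ∧ ∀ z ∈ lattice A, D • z ∈ AddSubgroup.closure {c | IsCircuit A c} := by
  classical
  obtain ⟨B₀, hB₀⟩ := exists_det_submatrix_ne_zero hrank
  obtain ⟨B, hB, hmin⟩ := Finset.exists_min_image
    (Finset.univ.filter fun B : Fin d → Fin n => (A.submatrix id B).det ≠ 0)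
    (fun B => padicValInt p (A.submatrix id B).det) ⟨B₀, by simpa using hB₀⟩
  simp only [Finset.mem_filter, Finset.mem_univ, true_and] at hB hmin
  have hinj := injective_of_det_ne_zero hB
  set e := padicValInt p (A.submatrix id B).det
  have hpe : (p : ℤ) ^ e ≠ 0 := pow_ne_zero _ (by exact_mod_cast (Fact.out : p.Prime).ne_zero)
  obtain ⟨D, hD⟩ : (p : ℤ) ^ e ∣ (A.submatrix id B).det := (padicValInt_dvd_iff _ _).2 (.inr le_rfl)
  have hD0 : ¬ (p : ℤ) ∣ D := by
    rintro ⟨q, rfl⟩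
    have h : (p : ℤ) ^ (e + 1) ∣ (A.submatrix id B).det := ⟨q, by rw [hD]; ring⟩
    rcases (padicValInt_dvd_iff _ _).1 h with h | h
    · exact hB h
    · omega
  have hcram : ∀ j, ∃ y : Fin d → ℤ, (A.submatrix id B).mulVec y = D • A.col j := by
    intro j
    have hdvd : ∀ b, (p : ℤ) ^ e ∣ (A.submatrix id B).cramer (A.col j) b := by
      intro b
      have h : (A.submatrix id B).updateCol b (A.col j) =
          A.submatrix id (Function.update B b j) := by
        ext r s
        by_cases hs : s = b
        · subst hs; simp
        · simp [hs]
      rw [Matrix.cramer_apply, h, padicValInt_dvd_iff]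
      by_cases h0 : (A.submatrix id (Function.update B b j)).det = 0
      · exact .inl h0
      · exact .inr (hmin _ h0)
    choose y hy using hdvd
    refine ⟨y, ?_⟩
    have h := Matrix.mulVec_cramer (A.submatrix id B) (A.col j)
    have hy' : (A.submatrix id B).cramer (A.col j) = (p : ℤ) ^ e • y := funext fun b => hy b
    rw [hy', Matrix.mulVec_smul, hD, mul_smul] at h
    exact smul_right_injective _ hpe h
  choose y hy using hcram
  -- the vector `D e_j` corrected on the basis `B` so as to lie in the lattice
  let c : Fin n → Fin n → ℤ := fun j i => ∑ b, if B b = i then y j b else 0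
  have hcB : ∀ j b, c j (B b) = y j b := fun j b => by
    simp [c, hinj.eq_iff]
  have hc0 : ∀ j, ∀ i ∉ Set.range B, c j i = 0 := fun j i hi =>
    Finset.sum_eq_zero fun b _ => if_neg fun h => hi ⟨b, h⟩
  let r : Fin n → Fin n → ℤ := fun j => D • Pi.single j 1 - c j
  have hrA : ∀ j, r j ∈ lattice A := fun j => by
    have h : c j ∘ B = y j := funext (hcB j)
    rw [mem_lattice, Matrix.mulVec_sub, mulVec_eq_submatrix_mulVec hinj (hc0 j), h, hy,
      Matrix.mulVec_smul, Matrix.mulVec_single_one, sub_self]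
  have hrC : ∀ j, r j ∈ AddSubgroup.closure {c | IsCircuit A c} := fun j =>
    mem_closure_of_support hB (hrA j) j fun i hi hij => by simp [r, hc0 j i hi, hij]
  refine ⟨D, hD0, fun z hz => ?_⟩
  -- Off `B` the vector `r j` equals `D e_j`, so the difference is a lattice vector supported on
  -- `B`.
  have h0 : D • z - ∑ j, z j • r j = 0 := by
    refine eq_zero_of_mem_lattice hB (sub_mem (Submodule.smul_mem _ _ hz)
      (Submodule.sum_mem _ fun j _ => Submodule.smul_mem _ _ (hrA j))) fun i hi => ?_
    simp [r, hc0 _ i hi, Pi.single_apply, mul_comm]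
  rw [sub_eq_zero.1 h0]
  exact sum_mem fun j _ => zsmul_mem (hrC j) _

/-- The multipliers taking `z` into the span of the circuits form an ideal of `ℤ`; for each prime
`p` it contains an element prime to `p`, so it is the unit ideal. -/
theorem mem_closure_circuits (hrank : (A.map (Int.cast : ℤ → ℝ)).rank = d) {z : Fin n → ℤ}
    (hz : z ∈ lattice A) : z ∈ AddSubgroup.closure {c | IsCircuit A c} := by
  let J : Ideal ℤ := ((AddSubgroup.closure {c | IsCircuit A c}).toIntSubmodule).comap
    (LinearMap.toSpanSingleton ℤ _ z)
  have hJ : ∀ t : ℤ, t ∈ J ↔ t • z ∈ AddSubgroup.closure {c | IsCircuit A c} := fun t => Iff.rfl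
  suffices h : J = ⊤ by
    have := (hJ 1).1 (h ▸ Submodule.mem_top)
    rwa [one_smul] at this
  by_contra hne
  obtain ⟨M, hM, hle⟩ := Ideal.exists_le_maximal J hne
  obtain ⟨g, rfl⟩ := IsPrincipalIdealRing.principal M
  have hJg : ∀ t ∈ J, g ∣ t := fun t ht => Ideal.mem_span_singleton.1 (hle ht)
  obtain ⟨p, hp, hpg⟩ : ∃ p : ℕ, p.Prime ∧ (p : ℤ) ∣ g := by
    -- The case `g = 0` needs no separate treatment: `Nat.minFac 0 = 2` divides it.
    refine ⟨g.natAbs.minFac, Nat.minFac_prime fun h => hM.ne_top ?_, ?_⟩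
    · exact Ideal.span_singleton_eq_top.2 (Int.isUnit_iff_natAbs_eq.2 h)
    · exact Int.natCast_dvd.2 (Nat.minFac_dvd _)
  have := Fact.mk hp
  obtain ⟨D, hD, hDz⟩ := exists_not_dvd_smul_mem_closure hrank p
  exact hD (hpg.trans (hJg D ((hJ D).2 (hDz z hz))))

/-! ### Circuits with prescribed signs -/

/-- Moving `v` along `-y` until the first coordinate vanishes. -/
theorem exists_vanishing_coordinate {σ : Finset (Fin n)} {i : Fin n} {v y : Fin n → ℝ}
    (hvi : v i < 0) (hvσ : ∀ j ∉ σ, v j ≤ 0) (hsupp : ∀ j, v j = 0 → y j = 0) (hyi : 0 ≤ y i)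
    (hpos : ∃ j, 0 < y j * v j) :
    ∃ t : ℝ, (v - t • y) i < 0 ∧ (∀ j ∉ σ, (v - t • y) j ≤ 0) ∧
      ∃ j, v j ≠ 0 ∧ (v - t • y) j = 0 := by
  -- With `ρ` the largest ratio `y j / v j`, the value `t = 1/ρ` is the first positive time a
  -- coordinate in the support of `v` vanishes; until then none changes sign. Where `v j = 0` the
  -- ratio is `0` and `y j = 0` too.
  obtain ⟨j₀, -, hj₀⟩ := Finset.exists_max_image Finset.univ (fun j => y j / v j) ⟨i, by simp⟩
  set ρ := y j₀ / v j₀ with hρ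
  have hρ0 : 0 < ρ := by
    obtain ⟨j, hj⟩ := hpos
    have hv : v j ≠ 0 := fun h => by simp [h] at hj
    have : y j / v j = (y j * v j) / (v j) ^ 2 := by field_simp
    exact lt_of_lt_of_le (by rw [this]; positivity) (hj₀ j (by simp))
  have hform : ∀ j, (v - ρ⁻¹ • y) j = v j * (1 - (y j / v j) / ρ) := fun j => by
    by_cases hv : v j = 0
    · simp [hv, hsupp j hv]
    · simp only [Pi.sub_apply, Pi.smul_apply, smul_eq_mul]
      field_simp
  refine ⟨ρ⁻¹, ?_, fun j hj => ?_, j₀, ?_, ?_⟩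
  · rw [Pi.sub_apply, Pi.smul_apply, smul_eq_mul]
    have : 0 ≤ ρ⁻¹ * y i := by positivity
    linarith
  · rw [hform]
    refine mul_nonpos_of_nonpos_of_nonneg (hvσ j hj) ?_
    rw [sub_nonneg, div_le_one hρ0]
    exact hj₀ j (by simp)
  · intro h
    simp [hρ, h] at hρ0
  · rw [hform, ← hρ, div_self hρ0.ne']; simp

/-- A kernel vector `v` of smallest support among those with the required signs has minimal support
among all real kernel vectors: otherwise, moving along a competitor kills a coordinate while keeping
the signs. The kernel vectors supported in `supp v` then form a line, which contains an integer
vector and hence a circuit. -/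
theorem exists_circuit_neg_apply {σ : Finset (Fin n)} {i : Fin n} {w : Fin n → ℝ}
    (hw : (A.map (Int.cast : ℤ → ℝ)).mulVec w = 0) (hwi : w i < 0) (hwσ : ∀ j ∉ σ, w j ≤ 0) :
    ∃ c, IsCircuit A c ∧ c i < 0 ∧ ∀ j ∉ σ, c j ≤ 0 := by
  classical
  let P : Set (Fin n → ℝ) := {v | (A.map (Int.cast : ℤ → ℝ)).mulVec v = 0 ∧ v i < 0 ∧
    ∀ j ∉ σ, v j ≤ 0}
  obtain ⟨v, ⟨hv, hvi, hvσ⟩, hmin'⟩ := (measure fun v : Fin n → ℝ =>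
    (Finset.univ.filter fun j => v j ≠ 0).card).wf.has_min P ⟨w, hw, hwi, hwσ⟩
  have hP : ∀ v' ∈ P, (∀ j, v j = 0 → v' j = 0) → ∀ j, v' j = 0 → v j = 0 := by
    intro v' hv' h j hj
    by_contra hne
    refine hmin' v' hv' (Finset.card_lt_card ?_)
    rw [Finset.ssubset_iff_of_subset]
    · exact ⟨j, by simpa using hne, by simpa using hj⟩
    · intro l
      simpa using fun h1 h2 => h1 (h l h2)
  -- minimality among all real kernel vectors
  have hmin : ∀ y : Fin n → ℝ, (A.map (Int.cast : ℤ → ℝ)).mulVec y = 0 →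
      (∀ j, v j = 0 → y j = 0) → (∃ j, y j = 0 ∧ v j ≠ 0) → y = 0 := by
    have key : ∀ y : Fin n → ℝ, (A.map (Int.cast : ℤ → ℝ)).mulVec y = 0 →
      (∀ j, v j = 0 → y j = 0) → 0 ≤ y i → ¬ ∃ j, 0 < y j * v j := by
      intro y hy hs hyi hpos
      obtain ⟨t, h1, h2, j, hj, hj'⟩ := exists_vanishing_coordinate hvi hvσ hs hyi hpos
      refine hj (hP (v - t • y) ⟨?_, h1, h2⟩ (fun j hj => ?_) j hj')
      · rw [Matrix.mulVec_sub, Matrix.mulVec_smul, hv, hy]; simp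
      · simp [hj, hs j hj]
    -- By `key` all products `y j * v j` are nonpositive. If `y i > 0`, then `-y` has the required
    -- signs and smaller support, which is impossible; if `y i = 0`, `key` applies to `-y` as well
    -- and forces `y = 0`.
    have key2 : ∀ y : Fin n → ℝ, (A.map (Int.cast : ℤ → ℝ)).mulVec y = 0 →
      (∀ j, v j = 0 → y j = 0) → (∃ j, y j = 0 ∧ v j ≠ 0) → 0 ≤ y i → y = 0 := by
      rintro y hy hs ⟨l, hl, hl'⟩ hyi
      have hnp : ∀ j, y j * v j ≤ 0 := fun j => not_lt.1 fun h => key y hy hs hyi ⟨j, h⟩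
      rcases hyi.eq_or_lt with hyi | hyi
      · have hnp' : ∀ j, 0 ≤ y j * v j := fun j => not_lt.1 fun h => by
          refine key (-y) (by rw [Matrix.mulVec_neg, hy, neg_zero]) (fun j hj => by simp [hs j hj])
            (by simp [← hyi]) ⟨j, ?_⟩
          simpa using h
        ext j
        by_cases hj : v j = 0
        · exact hs j hj
        · exact (mul_eq_zero.1 ((hnp j).antisymm (hnp' j))).resolve_right hj
      · refine absurd (hP (-y) ⟨by rw [Matrix.mulVec_neg, hy, neg_zero], by simpa using hyi, ?_⟩
          (fun j hj => by simp [hs j hj]) l (by simpa using hl)) hl'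
        intro j hj
        rcases (hvσ j hj).eq_or_lt with h | h
        · simp [hs j h]
        · have := hnp j
          simp only [Pi.neg_apply, Left.neg_nonpos_iff]
          nlinarith
    intro y hy hs hl
    rcases le_total 0 (y i) with hyi | hyi
    · exact key2 y hy hs hl hyi
    · exact neg_eq_zero.1 (key2 (-y) (by rw [Matrix.mulVec_neg, hy, neg_zero])
        (fun j hj => by simp [hs j hj]) (by simpa using hl) (by simpa using hyi))
  -- a rational vector proportional to `v`
  obtain ⟨f, hf⟩ : ∃ f : Module.Dual ℚ ℝ, f (v i) ≠ 0 := by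
    by_contra! h
    exact hvi.ne ((Module.forall_dual_apply_eq_zero_iff ℚ (v i)).1 h)
  obtain ⟨D, hD, z, hz⟩ : ∃ D : ℤ, D ≠ 0 ∧ ∃ z : Fin n → ℤ, ∀ j, (z j : ℚ) = D * f (v j) := by
    obtain ⟨D, hD⟩ := IsLocalization.exist_integer_multiples_of_finite (nonZeroDivisors ℤ)
      fun j => f (v j)
    choose z hz using hD
    refine ⟨D, nonZeroDivisors.coe_ne_zero D, z, fun j => ?_⟩
    have := hz j
    simpa using this
  have hzA : z ∈ lattice A := by
    rw [mem_lattice]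
    ext r
    have h1 := congrFun hv r
    simp only [Matrix.mulVec, dotProduct, Matrix.map_apply, Pi.zero_apply] at h1 ⊢
    have h2 : ∑ j, (A r j : ℚ) * f (v j) = 0 := by
      rw [← map_zero f, ← h1, map_sum]
      refine Finset.sum_congr rfl fun j _ => ?_
      have : (A r j : ℝ) * v j = (A r j : ℚ) • v j := by
        rw [Rat.smul_def]; simp
      rw [this, map_smul, smul_eq_mul]
    have h3 : ((∑ j, A r j * z j : ℤ) : ℚ) = 0 := by
      push_cast
      rw [← mul_zero (D : ℚ), ← h2, Finset.mul_sum]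
      exact Finset.sum_congr rfl fun j _ => by rw [hz]; ring
    exact_mod_cast h3
  have hreal : ∀ {z : Fin n → ℤ}, z ∈ lattice A →
      (A.map (Int.cast : ℤ → ℝ)).mulVec (fun j => (z j : ℝ)) = 0 := by
    intro z hz
    ext r
    have := congrFun (mem_lattice.1 hz) r
    simp only [Matrix.mulVec, dotProduct, Matrix.map_apply, Pi.zero_apply] at this ⊢
    exact_mod_cast this
  have hzv : ∀ j, v j = 0 → z j = 0 := fun j hj => by
    have := hz j
    rw [hj, map_zero, mul_zero] at this
    exact_mod_cast this
  have hzi : z i ≠ 0 := fun h => by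
    have := hz i
    rw [h, Int.cast_zero] at this
    exact mul_ne_zero (by exact_mod_cast hD) hf this.symm
  have hprop : ∀ j, (z i : ℝ) * v j = v i * z j := by
    have := hmin ((z i : ℝ) • v - v i • fun j => (z j : ℝ)) ?_ ?_ ⟨i, ?_, hvi.ne⟩
    · intro j
      have := congrFun this j
      simpa [sub_eq_zero] using this
    · rw [Matrix.mulVec_sub, Matrix.mulVec_smul, Matrix.mulVec_smul, hv, hreal hzA]; simp
    · intro j hj
      simp [hj, hzv j hj]
    · simp [mul_comm]
  have hzv' : ∀ j, z j = 0 ↔ v j = 0 := fun j => by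
    refine ⟨fun h => ?_, hzv j⟩
    have := hprop j
    rw [h, Int.cast_zero, mul_zero] at this
    exact (mul_eq_zero.1 this).resolve_left (by exact_mod_cast hzi)
  -- choose the sign so that `z i < 0`
  obtain ⟨z', hz'A, hz'i, hz'σ, hz'v⟩ : ∃ z' ∈ lattice A, z' i < 0 ∧ (∀ j ∉ σ, z' j ≤ 0) ∧
      ∀ j, z' j = 0 ↔ v j = 0 := by
    rcases hzi.lt_or_gt with h | h
    · refine ⟨z, hzA, h, fun j hj => ?_, hzv'⟩
      have h1 := hprop j
      have h2 := hvσ j hj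
      have h : (z i : ℝ) < 0 := by exact_mod_cast h
      have : (z j : ℝ) ≤ 0 := by
        by_contra! h3
        have := mul_nonneg_of_nonpos_of_nonpos h.le h2
        have := mul_neg_of_neg_of_pos hvi h3
        linarith
      exact_mod_cast this
    · refine ⟨-z, neg_mem hzA, by simpa using h, fun j hj => ?_, by simpa using hzv'⟩
      have h1 := hprop j
      have h2 := hvσ j hj
      have h : (0 : ℝ) < z i := by exact_mod_cast h
      have : (0 : ℝ) ≤ z j := by
        by_contra! h3
        have := mul_nonpos_of_nonneg_of_nonpos h.le h2
        have := mul_pos_of_neg_of_neg hvi h3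
        linarith
      simpa using (by exact_mod_cast this : 0 ≤ z j)
  have hz'min : ¬ ∃ y ∈ lattice A, y ≠ 0 ∧ Function.support y ⊂ Function.support z' := by
    rintro ⟨y, hyA, hy0, hss⟩
    obtain ⟨l, hl, hl'⟩ := Set.exists_of_ssubset hss
    refine hy0 ?_
    have := hmin (fun j => (y j : ℝ)) (hreal hyA) (fun j hj => ?_) ⟨l, ?_, ?_⟩
    · ext j
      simpa using congrFun this j
    · by_contra h
      exact hss.1 (show y j ≠ 0 by exact_mod_cast h) ((hz'v j).2 hj)
    · simpa using hl'
    · exact fun h => hl ((hz'v l).2 h)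
  obtain ⟨g, c, hg, rfl, hc⟩ := exists_circuit_of_minimal_support hz'A
    (fun h => by simp [h] at hz'i) hz'min
  refine ⟨c, hc, ?_, fun j hj => ?_⟩
  · exact (pos_iff_neg_of_mul_neg (by simpa using hz'i)).1 hg
  · have := hz'σ j hj
    simp only [Pi.smul_apply, smul_eq_mul] at this
    by_contra! h
    nlinarith

/-- Multiplying the chosen circuit congruences gives `P ~ Q` with `P` supported on `σ` and `Q ≥ 1`
off `σ`. The summand `1` in `M` makes `r = M • ind σ - P` at least `1` on `σ`, so `Q + r` has full
support. -/
theorem covers_of_exists_circuits {σ : Finset (Fin n)}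
    (h : ∀ i ∉ σ, ∃ c, IsCircuit A c ∧ c i < 0 ∧ ∀ j ∉ σ, c j ≤ 0) : Covers k A σ := by
  classical
  choose! c hc hci hcσ using h
  set P : Fin n →₀ ℕ := ∑ i ∈ σᶜ, pos (c i)
  set Q : Fin n →₀ ℕ := ∑ i ∈ σᶜ, neg (c i)
  have hPQ : binomial k P Q ∈ circuitIdeal k A :=
    cong_sum _ _ _ fun i hi => circuit_cong (hc i (by simpa using hi))
  have hP : ∀ j ∉ σ, P j = 0 := fun j hj => by
    simp only [P, Finsupp.finsetSum_apply, pos_apply]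
    exact Finset.sum_eq_zero fun i hi => by
      have := hcσ i (by simpa using hi) j hj
      omega
  have hQ : ∀ i ∉ σ, 1 ≤ Q i := fun i hi => by
    have h1 : neg (c i) i ≤ Q i := by
      simp only [Q, Finsupp.finsetSum_apply]
      exact Finset.single_le_sum (f := fun l => neg (c l) i) (by simp) (by simpa using hi)
    have := hci i hi
    simp only [neg_apply] at h1
    omega
  set M := 1 + ∑ j, P j
  have hM : ∀ j, P j + 1 ≤ M := fun j => by
    have := Finset.single_le_sum (f := fun j => P j) (by simp) (Finset.mem_univ j)
    omega
  set r : Fin n →₀ ℕ := M • ind σ - P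
  have hr : ∀ i, r i = (if i ∈ σ then M else 0) - P i := fun i => by simp [r]
  have hMr : M • ind σ = P + r := by
    ext j
    rw [Finsupp.add_apply, hr]
    have := hM j
    by_cases hj : j ∈ σ
    · simp [hj]; omega
    · simp [hj, hP j hj]
  refine ⟨M, Q + r, fun i => ?_, ?_⟩
  · rw [Finsupp.add_apply, hr]
    by_cases hi : i ∈ σ
    · have := hM i
      simp [hi]; omega
    · have := hQ i hi
      omega
  · rw [hMr]
    exact cong_add_right r hPQ

/-! ### Subsets whose columns meet the interior of the cone -/

theorem sum_smul_toEuclidean_apply (c : Fin n → ℝ) (r : Fin d) :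
    (∑ i, c i • toEuclidean (A.col i)) r = (A.map (Int.cast : ℤ → ℝ)).mulVec c r := by
  simp [toEuclidean, Matrix.mulVec, dotProduct, mul_comm]

/-- Subtracting a small multiple of `a_i` from the interior point stays in the cone. Comparing the
two expressions gives a real relation that is negative at `i` and nonpositive wherever `μ` vanishes.
-/
theorem covers_of_mem_interior {σ : Finset (Fin n)} {μ : Fin n → ℝ} (hμ : ∀ j ∉ σ, μ j = 0)
    (hint : ∑ j, μ j • toEuclidean (A.col j) ∈ interior (cone A)) : Covers k A σ := by
  classical
  refine covers_of_exists_circuits fun i hi => ?_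
  set x := ∑ j, μ j • toEuclidean (A.col j)
  have hcont : Continuous fun t : ℝ => x - t • toEuclidean (A.col i) := by fun_prop
  have hnhds : ∀ᶠ t in nhds (0 : ℝ), x - t • toEuclidean (A.col i) ∈ cone A := by
    refine hcont.continuousAt.eventually_mem ?_
    simpa using mem_interior_iff_mem_nhds.1 hint
  obtain ⟨ε, hε, hε'⟩ := Metric.eventually_nhds_iff.1 hnhds
  obtain ⟨l, hl, hxl⟩ := hε' (y := ε / 2) (by simp [abs_of_pos hε]; linarith)
  refine exists_circuit_neg_apply (w := μ - (ε / 2) • Pi.single i 1 - l) ?_ ?_ ?_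
  · ext r
    have h := congrArg (fun y : EuclideanSpace ℝ (Fin d) => y r) hxl
    simp only [PiLp.sub_apply, PiLp.smul_apply] at h
    rw [sum_smul_toEuclidean_apply, sum_smul_toEuclidean_apply] at h
    rw [Matrix.mulVec_sub, Matrix.mulVec_sub, Matrix.mulVec_smul, Matrix.mulVec_single_one]
    simp only [Pi.sub_apply, Pi.smul_apply, Pi.zero_apply, ← h]
    simp [toEuclidean]
  · have := hl i
    simp [hμ i hi]
    linarith
  · intro j hj
    have := hl j
    by_cases hij : j = i
    · subst hij; simp [hμ j hj]; linarith
    · simp [hμ j hj, hij]; linarith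

/-! ### Fibers of a pointed configuration -/

/-- Pointedness makes a fiber an antichain in `ℕⁿ`, and Dickson's lemma applies. -/
theorem fiber_finite (hpointed : ∀ u : Fin n → ℤ, u ∈ lattice A → (∀ i, 0 ≤ u i) → u = 0)
    (b : Fin d → ℤ) : (fiber A b).Finite := by
  have hanti : IsAntichain (· ≤ ·) (fiber A b) := by
    intro u hu v hv hne hle
    refine hne ?_
    have h : degMap A v = degMap A u := hv.trans hu.symm
    have := hpointed _ (degMap_eq_iff.1 h) fun i => by have := hle i; omega
    ext i
    have := congrFun this i
    simp only [Pi.zero_apply] at this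
    omega
  exact hanti.finite_of_partiallyWellOrderedOn (Set.isPWO_of_wellQuasiOrderedLE _)

/-! ### Initial forms -/

theorem weight_add (ω : Fin n → ℝ) (u v : Fin n →₀ ℕ) :
    weight ω (u + v) = weight ω u + weight ω v := by
  simp [weight, mul_add, Finset.sum_add_distrib]

open Classical in
theorem coeff_initialForm (ω : Fin n → ℝ) (f : MvPolynomial (Fin n) k) (u : Fin n →₀ ℕ) :
    coeff u (initialForm ω f) =
      if ∀ v ∈ f.support, weight ω v ≤ weight ω u then coeff u f else 0 := by
  rw [initialForm, coeff_sum]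
  simp only [coeff_monomial]
  rw [Finset.sum_ite_eq' _ u]
  by_cases hu : u ∈ f.support
  · simp [hu]
  · simp [notMem_support_iff.1 hu]

theorem initialForm_monomial_mul (ω : Fin n → ℝ) (w : Fin n →₀ ℕ) (f : MvPolynomial (Fin n) k) :
    initialForm ω (monomial w 1 * f) = monomial w 1 * initialForm ω f := by
  classical
  have hcoeff : ∀ v, coeff (w + v) (monomial w 1 * f) = coeff v f := fun v => by
    rw [coeff_monomial_mul, one_mul]
  ext u
  by_cases hwu : w ≤ u
  · obtain ⟨u, rfl⟩ := exists_add_of_le hwu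
    rw [coeff_monomial_mul, one_mul, coeff_initialForm, coeff_initialForm, hcoeff]
    congr 1
    refine propext ⟨fun h v hv => ?_, fun h v hv => ?_⟩
    · have := h (w + v) (by rwa [mem_support_iff, hcoeff, ← mem_support_iff])
      rw [weight_add, weight_add] at this
      linarith
    · by_cases hwv : w ≤ v
      · obtain ⟨v, rfl⟩ := exists_add_of_le hwv
        rw [mem_support_iff, hcoeff, ← mem_support_iff] at hv
        rw [weight_add, weight_add]
        linarith [h v hv]
      · rw [mem_support_iff, coeff_monomial_mul', if_neg hwv] at hv
        exact absurd rfl hv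
  · rw [coeff_monomial_mul', if_neg hwu, coeff_initialForm, coeff_monomial_mul', if_neg hwu,
      ite_self]

open Classical in
theorem coeff_binomial (p q u : Fin n →₀ ℕ) :
    coeff u (binomial k p q) = (if p = u then 1 else 0) - (if q = u then 1 else 0) := by
  simp [binomial, coeff_monomial]

theorem mem_support_binomial {p q : Fin n →₀ ℕ} (h : p ≠ q) (u : Fin n →₀ ℕ) :
    u ∈ (binomial k p q).support ↔ u = p ∨ u = q := by
  classical
  rw [mem_support_iff, coeff_binomial]
  by_cases hp : p = u
  · subst hp; simp [h.symm]
  · by_cases hq : q = u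
    · subst hq; simp [h]
    · simp [hp, hq, Ne.symm hp, Ne.symm hq]

theorem initialForm_binomial {ω : Fin n → ℝ} {p q : Fin n →₀ ℕ} (h : weight ω q < weight ω p) :
    initialForm ω (binomial k p q) = monomial p 1 := by
  classical
  have hne : p ≠ q := fun h' => by simp [h'] at h
  ext u
  rw [coeff_initialForm, coeff_monomial]
  simp only [mem_support_binomial hne, forall_eq_or_imp, forall_eq, coeff_binomial]
  by_cases hp : p = u
  · subst hp; simp [h.le, hne.symm]
  · by_cases hq : q = u
    · subst hq; simp [h, hp]
    · simp [hp, hq]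

theorem initialForm_mem {ω : Fin n → ℝ} {I : Ideal (MvPolynomial (Fin n) k)}
    {f : MvPolynomial (Fin n) k} (hf : f ∈ I) : initialForm ω f ∈ initialIdeal ω I :=
  Ideal.subset_span ⟨f, hf, rfl⟩

theorem initialIdeal_mono {ω : Fin n → ℝ} {I J : Ideal (MvPolynomial (Fin n) k)} (h : I ≤ J) :
    initialIdeal ω I ≤ initialIdeal ω J :=
  Ideal.span_mono (Set.image_mono h)

theorem IsMonomialIdeal.monomial_mem {M : Ideal (MvPolynomial (Fin n) k)} (hM : IsMonomialIdeal M)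
    {f : MvPolynomial (Fin n) k} (hf : f ∈ M) {u : Fin n →₀ ℕ} (hu : u ∈ f.support) :
    monomial u (1 : k) ∈ M := by
  obtain ⟨S, rfl⟩ := hM
  rw [mem_ideal_span_monomial_image] at hf ⊢
  intro v hv
  have hvu : v = u := by simpa using support_monomial_subset hv
  exact hvu ▸ hf u hu

theorem exists_mem_support_monomial_mem {ω : Fin n → ℝ} {I : Ideal (MvPolynomial (Fin n) k)}
    (hM : IsMonomialIdeal (initialIdeal ω I)) {f : MvPolynomial (Fin n) k} (hf : f ∈ I)
    (hf0 : f ≠ 0) : ∃ u ∈ f.support, monomial u (1 : k) ∈ initialIdeal ω I := by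
  classical
  obtain ⟨u, hu, hmax⟩ := Finset.exists_max_image f.support (weight ω) (support_nonempty.2 hf0)
  refine ⟨u, hu, hM.monomial_mem (initialForm_mem hf) ?_⟩
  rw [mem_support_iff, coeff_initialForm, if_pos hmax]
  exact mem_support_iff.1 hu

/-! ### Initial monomials of the circuit ideal -/

open Classical in
theorem coeffSum_initialForm (S : Set (Fin n →₀ ℕ)) (ω : Fin n → ℝ) (f : MvPolynomial (Fin n) k) :
    coeffSum S (initialForm ω f) = ∑ u ∈ f.support,
      if ∀ v ∈ f.support, weight ω v ≤ weight ω u then if u ∈ S then coeff u f else 0 else 0 := by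
  rw [initialForm, map_sum, Finset.sum_filter]
  simp only [coeffSum_monomial]

/-- A monomial in the initial ideal of the circuit ideal is congruent to one of lower weight. -/
theorem exists_cong_weight_lt {ω : Fin n → ℝ} {m : Fin n →₀ ℕ}
    (hm : monomial m (1 : k) ∈ initialIdeal ω (circuitIdeal k A)) :
    ∃ q, binomial k m q ∈ circuitIdeal k A ∧ weight ω q < weight ω m := by
  classical
  by_contra! hlow
  set T : Set (Fin n →₀ ℕ) := {w | binomial k m w ∈ circuitIdeal k A}
  set S : Set (Fin n →₀ ℕ) := {w | w ∈ T ∧ weight ω w = weight ω m}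
  -- Here `m` has least weight in its class `T`. If a top term of `f` lies in `S`, then all terms of
  -- `f` in `T` have that same weight, so the sum over `S` of the initial form equals the sum over
  -- `T` of `f`, which is zero. The functional thus kills the initial ideal but not `x^m`.
  have hinit : ∀ f ∈ circuitIdeal k A, coeffSum S (initialForm ω f) = 0 := by
    intro f hf
    have hT : coeffSum T f = 0 := coeffSum_eq_zero_of_mem_circuitIdeal
      (fun u v huv => ⟨fun h => cong_trans h huv, fun h => cong_trans h (cong_symm huv)⟩) hf
    rw [coeffSum_initialForm]
    by_cases hex : ∃ u ∈ f.support, (∀ v ∈ f.support, weight ω v ≤ weight ω u) ∧ u ∈ S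
    · obtain ⟨u₀, -, hmax, hu₀⟩ := hex
      rw [coeffSum_apply] at hT
      refine (Finset.sum_congr rfl fun u hu => ?_).trans hT
      by_cases huT : u ∈ T
      · have h1 := hlow u huT
        have h2 := hmax u hu
        rw [hu₀.2] at h2
        have huS : u ∈ S := ⟨huT, h2.antisymm h1⟩
        rw [if_pos huT, if_pos huS, if_pos fun v hv => (hmax v hv).trans (hu₀.2.trans huS.2.symm).le]
      · have huS : u ∉ S := fun h => huT h.1
        rw [if_neg huT, if_neg huS, ite_self]
    · push Not at hex
      refine Finset.sum_eq_zero fun u hu => ?_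
      split_ifs with h1 h2
      · exact absurd h2 (hex u hu h1)
      · rfl
      · rfl
  have hall : ∀ f ∈ initialIdeal ω (circuitIdeal k A), ∀ g, coeffSum S (g * f) = 0 := by
    intro f hf
    induction hf using Submodule.span_induction with
    | mem x hx =>
      obtain ⟨f, hf, rfl⟩ := hx
      intro g
      induction g using MvPolynomial.induction_on' with
      | monomial u a =>
        have : monomial u a * initialForm ω f = a • initialForm ω (monomial u 1 * f) := by
          rw [initialForm_monomial_mul, ← smul_mul_assoc, smul_monomial, smul_eq_mul, mul_one]
        rw [this, map_smul, hinit _ (Ideal.mul_mem_left _ _ hf), smul_zero]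
      | add p q hp hq => rw [add_mul, map_add, hp, hq, add_zero]
    | zero => simp
    | add x y _ _ hx hy => intro g; rw [mul_add, map_add, hx, hy, add_zero]
    | smul a x _ hx => intro g; rw [smul_eq_mul, ← mul_assoc]; exact hx _
  have h := hall _ hm 1
  rw [one_mul, coeffSum_monomial, if_pos ⟨cong_refl (circuitIdeal k A) m, rfl⟩] at h
  exact one_ne_zero h

theorem exists_cong_standard
    (hpointed : ∀ u : Fin n → ℤ, u ∈ lattice A → (∀ i, 0 ≤ u i) → u = 0)
    (ω : Fin n → ℝ) (m : Fin n →₀ ℕ) :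
    ∃ q, binomial k m q ∈ circuitIdeal k A ∧
      monomial q (1 : k) ∉ initialIdeal ω (circuitIdeal k A) ∧
      ∀ w, binomial k m w ∈ circuitIdeal k A → weight ω q ≤ weight ω w := by
  have hfin : {q | binomial k m q ∈ circuitIdeal k A}.Finite :=
    (fiber_finite hpointed (degMap A m)).subset fun q hq => (degMap_eq_of_mem_circuitIdeal hq).symm
  obtain ⟨q, hq, hmin⟩ := Set.exists_min_image _ (weight ω) hfin ⟨m, cong_refl (circuitIdeal k A) m⟩
  refine ⟨q, hq, fun h => ?_, hmin⟩
  obtain ⟨q', hq', hlt⟩ := exists_cong_weight_lt h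
  exact absurd (hmin q' (cong_trans hq hq')) (not_le.2 hlt)

/-- A nonstandard exponent reduces by a binomial of the reduced Gröbner basis. -/
theorem exists_reduction
    (hpointed : ∀ u : Fin n → ℤ, u ∈ lattice A → (∀ i, 0 ≤ u i) → u = 0)
    {ω : Fin n → ℝ} {u : Fin n →₀ ℕ}
    (hu : monomial u (1 : k) ∈ initialIdeal ω (circuitIdeal k A)) :
    ∃ p q w : Fin n →₀ ℕ, binomial k p q ∈ reducedGroebnerBasis ω (circuitIdeal k A) ∧
      weight ω q < weight ω p ∧ u = w + p := by
  obtain ⟨p, hpu, hp⟩ := exists_minimal_le_of_wellFoundedLT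
    (fun e => monomial e (1 : k) ∈ initialIdeal ω (circuitIdeal k A)) u hu
  obtain ⟨q, hpq, hq, hmin⟩ := exists_cong_standard (k := k) hpointed ω p
  obtain ⟨q', hpq', hlt'⟩ := exists_cong_weight_lt hp.1
  have hlt := (hmin q' hpq').trans_lt hlt'
  obtain ⟨w, rfl⟩ := exists_add_of_le hpu
  refine ⟨p, q, w, ⟨hpq, p, hp, initialForm_binomial hlt, fun e he hne => ?_⟩, hlt, add_comm _ _⟩
  have hne' : p ≠ q := fun h => by simp [h] at hlt
  rw [mem_support_binomial hne'] at he
  rwa [he.resolve_left hne]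

/-! ### Connectedness of the fiber graphs -/

/-- Every vertex reduces to a standard one, as weights drop along arrows in a finite fiber. Two
distinct congruent standard exponents would give a binomial in the ideal with no term in the
monomial initial ideal, so all reductions end at the same vertex. -/
theorem fiberDigraph_connected
    (hpointed : ∀ u : Fin n → ℤ, u ∈ lattice A → (∀ i, 0 ≤ u i) → u = 0)
    {ω : Fin n → ℝ} (hω : IsMonomialIdeal (initialIdeal ω (circuitIdeal k A))) {b : Fin d → ℤ}
    (hb : (fiber A b).Nonempty)
    (hcong : ∀ u ∈ fiber A b, ∀ v ∈ fiber A b, binomial k u v ∈ circuitIdeal k A) :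
    (fiberDigraph A ω (circuitIdeal k A) b).toSimpleGraphInclusive.Connected := by
  set Γ := (fiberDigraph A ω (circuitIdeal k A) b).toSimpleGraphInclusive
  have := (fiber_finite hpointed b).to_subtype
  have hstd : ∀ u : fiber A b, ∃ s : fiber A b, Γ.Reachable u s ∧
      monomial s.1 (1 : k) ∉ initialIdeal ω (circuitIdeal k A) := by
    intro u
    induction u using (Finite.wellFounded_of_trans_of_irrefl
      (InvImage (· < ·) fun u : fiber A b => weight ω u.1)).induction with
    | _ u ih =>
    by_cases hu : monomial u.1 (1 : k) ∈ initialIdeal ω (circuitIdeal k A)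
    · obtain ⟨p, q, w, hpq, hlt, hw⟩ := exists_reduction hpointed hu
      have hv : w + q ∈ fiber A b := by
        have h := degMap_eq_of_mem_circuitIdeal hpq.1
        have hu' : degMap A u.1 = b := u.2
        rw [hw, map_add, h, ← map_add] at hu'
        exact hu'
      have hlt' : weight ω (w + q) < weight ω u.1 := by
        rw [hw, weight_add, weight_add]; linarith
      obtain ⟨s, hs, hs'⟩ := ih ⟨w + q, hv⟩ hlt'
      refine ⟨s, SimpleGraph.Reachable.trans (SimpleGraph.Adj.reachable ?_) hs, hs'⟩
      refine (SimpleGraph.fromRel_adj _ _ _).2 ⟨fun h => ?_, .inl ⟨p, q, w, hpq,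
        initialForm_binomial hlt, hw, rfl⟩⟩
      exact hlt'.ne (congrArg (fun v : fiber A b => weight ω v.1) h).symm
    · exact ⟨u, SimpleGraph.Reachable.refl u, hu⟩
  have := hb.to_subtype
  refine SimpleGraph.Connected.mk fun u v => ?_
  obtain ⟨s, hus, hs⟩ := hstd u
  obtain ⟨t, hvt, ht⟩ := hstd v
  have hst : s = t := by
    by_contra hne
    have hne' : s.1 ≠ t.1 := fun h => hne (Subtype.ext h)
    have hsupp := mem_support_binomial (k := k) hne'
    obtain ⟨e, he, he'⟩ := exists_mem_support_monomial_mem hω (hcong _ s.2 _ t.2)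
      (support_nonempty.1 ⟨s.1, (hsupp _).2 (.inl rfl)⟩)
    rcases (hsupp e).1 he with rfl | rfl
    · exact hs he'
    · exact ht he'
  exact hus.trans (hst ▸ hvt.symm)

/-- The connected component of `u` is stable under moves by `G`, so a binomial in the ideal cannot
leave it. -/
theorem fiberGraph_connected {G : Set (MvPolynomial (Fin n) k)}
    (hG : IsBinomialGeneratingSet G (circuitIdeal k A)) {b : Fin d → ℤ}
    (hb : (fiber A b).Nonempty)
    (hcong : ∀ u ∈ fiber A b, ∀ v ∈ fiber A b, binomial k u v ∈ circuitIdeal k A) :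
    (fiberGraph A G b).Connected := by
  have := hb.to_subtype
  refine SimpleGraph.Connected.mk fun u v => ?_
  have hmem := hcong u.1 u.2 v.1 v.2
  rw [← hG.2] at hmem
  have hadj : ∀ p q w, binomial k p q ∈ G → p ≠ q → ∀ (hp : w + p ∈ fiber A b)
      (hq : w + q ∈ fiber A b), (fiberGraph A G b).Reachable ⟨w + p, hp⟩ ⟨w + q, hq⟩ := by
    intro p q w hpq hne hp hq
    refine SimpleGraph.Adj.reachable ((SimpleGraph.fromRel_adj _ _ _).2
      ⟨fun h => hne ?_, .inl ⟨_, hpq, w, (monomial_mul_binomial w p q).symm⟩⟩)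
    simpa using h
  have := (mem_iff_of_binomial_mem_span
    (S := {w | ∃ h : w ∈ fiber A b, (fiberGraph A G b).Reachable u ⟨w, h⟩}) ?_ hmem).1
    ⟨u.2, SimpleGraph.Reachable.refl u⟩
  · exact this.2
  · intro g hg
    obtain ⟨p, q, hne, rfl⟩ := hG.1 g hg
    refine ⟨p, q, rfl, fun w => ?_⟩
    have hdeg : degMap A (w + p) = degMap A (w + q) := by
      have hpq : binomial k p q ∈ circuitIdeal k A := hG.2 ▸ Ideal.subset_span hg
      rw [map_add, map_add, degMap_eq_of_mem_circuitIdeal hpq]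
    constructor
    · rintro ⟨hp, h⟩
      have hq : w + q ∈ fiber A b := hdeg.symm.trans hp
      exact ⟨hq, h.trans (hadj p q w hg hne hp hq)⟩
    · rintro ⟨hq, h⟩
      have hp : w + p ∈ fiber A b := hdeg.trans hq
      exact ⟨hp, h.trans (hadj p q w hg hne hp hq).symm⟩

/-! ### The Hilbert function -/

theorem hilbertFunction_eq_one {b : Fin d → ℤ} (hb : (fiber A b).Nonempty)
    (hcong : ∀ u ∈ fiber A b, ∀ v ∈ fiber A b, binomial k u v ∈ circuitIdeal k A) :
    hilbertFunction A (circuitIdeal k A) b = 1 := by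
  obtain ⟨u, hu⟩ := hb
  set φ := (Ideal.Quotient.mkₐ k (circuitIdeal k A)).toLinearMap
  have hφ : ∀ f, φ f = 0 ↔ f ∈ circuitIdeal k A := fun f => Ideal.Quotient.eq_zero_iff_mem
  have hspan : (weightedHomogeneousSubmodule k A.col b).map φ =
      Submodule.span k {φ (monomial u 1)} := by
    refine le_antisymm ?_ ?_
    · rw [Submodule.map_le_iff_le_comap]
      intro f hf
      rw [Submodule.mem_comap, ← support_sum_monomial_coeff f, map_sum]
      refine Submodule.sum_mem _ fun v hv => ?_
      have hv' : v ∈ fiber A b := hf (mem_support_iff.1 hv)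
      have heq : φ (monomial v (coeff v f)) = coeff v f • φ (monomial u 1) := by
        rw [← map_smul, ← sub_eq_zero, ← map_sub, hφ]
        have := (circuitIdeal k A).mul_mem_left (C (coeff v f)) (hcong v hv' u hu)
        convert this using 1
        rw [binomial, mul_sub, C_mul_monomial, C_mul', mul_one]
      rw [heq]
      exact Submodule.smul_mem _ _ (Submodule.mem_span_singleton_self _)
    · rw [Submodule.span_singleton_le_iff_mem]
      exact ⟨_, isWeightedHomogeneous_monomial _ _ _ hu, rfl⟩
  rw [hilbertFunction, hspan]
  refine finrank_span_singleton fun h => monomial_notMem_circuitIdeal (A := A) u ((hφ _).1 h)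

/-! ### Facets of the cone -/

theorem exists_eq_sum_smul (hrank : (A.map (Int.cast : ℤ → ℝ)).rank = d)
    (y : EuclideanSpace ℝ (Fin d)) : ∃ c : Fin n → ℝ, ∑ i, c i • toEuclidean (A.col i) = y := by
  have htop : LinearMap.range (A.map (Int.cast : ℤ → ℝ)).mulVecLin = ⊤ :=
    Submodule.eq_top_of_finrank_eq (by rw [← Matrix.rank, hrank]; simp)
  obtain ⟨c, hc⟩ := LinearMap.range_eq_top.1 htop (WithLp.ofLp y)
  refine ⟨c, ?_⟩
  ext r
  rw [sum_smul_toEuclidean_apply]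
  exact congrFun hc r

theorem toEuclidean_col_mem_cone (A : Matrix (Fin d) (Fin n) ℤ) (i : Fin n) :
    toEuclidean (A.col i) ∈ cone A := by
  classical
  refine ⟨Pi.single i 1, fun j => ?_, ?_⟩
  · by_cases h : j = i
    · subst h; simp
    · simp [h]
  · simp [Pi.single_apply, ite_smul]

theorem zero_mem_cone (A : Matrix (Fin d) (Fin n) ℤ) : 0 ∈ cone A :=
  ⟨0, by simp, by simp⟩

theorem smul_mem_cone {x : EuclideanSpace ℝ (Fin d)} (hx : x ∈ cone A) {t : ℝ} (ht : 0 ≤ t) :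
    t • x ∈ cone A := by
  obtain ⟨c, hc, rfl⟩ := hx
  exact ⟨fun i => t * c i, fun i => mul_nonneg ht (hc i), by simp [Finset.smul_sum, mul_smul]⟩

theorem convex_cone (A : Matrix (Fin d) (Fin n) ℤ) : Convex ℝ (cone A) := by
  rintro _ ⟨c, hc, rfl⟩ _ ⟨c', hc', rfl⟩ s t hs ht -
  refine ⟨fun i => s * c i + t * c' i, fun i => ?_, ?_⟩
  · have := hc i
    have := hc' i
    positivity
  · simp [Finset.smul_sum, mul_smul, add_smul, Finset.sum_add_distrib]

theorem interior_cone_nonempty (hrank : (A.map (Int.cast : ℤ → ℝ)).rank = d) :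
    (interior (cone A)).Nonempty := by
  let T : (Fin n → ℝ) →ₗ[ℝ] EuclideanSpace ℝ (Fin d) :=
    Fintype.linearCombination ℝ fun i => toEuclidean (A.col i)
  have hT : ∀ c, T c = ∑ i, c i • toEuclidean (A.col i) := fun c =>
    Fintype.linearCombination_apply ..
  have hopen : IsOpenMap T := LinearMap.isOpenMap_of_finiteDimensional T fun y => by
    obtain ⟨c, hc⟩ := exists_eq_sum_smul hrank y
    exact ⟨c, (hT c).trans hc⟩
  have hset : IsOpen (Set.univ.pi fun _ : Fin n => Set.Ioi (0 : ℝ)) :=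
    isOpen_set_pi Set.finite_univ fun _ _ => isOpen_Ioi
  refine ⟨T fun _ => 1, interior_maximal ?_ (hopen _ hset) ⟨_, by simp, rfl⟩⟩
  rintro _ ⟨c, hc, rfl⟩
  exact ⟨c, fun i => (hc i (Set.mem_univ i)).le, hT c⟩

theorem inner_nonneg_of_mem_cone {c : EuclideanSpace ℝ (Fin d)}
    (hc : ∀ i, 0 ≤ inner ℝ c (toEuclidean (A.col i))) {x : EuclideanSpace ℝ (Fin d)}
    (hx : x ∈ cone A) : 0 ≤ inner ℝ c x := by
  obtain ⟨l, hl, rfl⟩ := hx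
  rw [inner_sum]
  refine Finset.sum_nonneg fun i _ => ?_
  rw [inner_smul_right]
  exact mul_nonneg (hl i) (hc i)

/-- Hahn–Banach separates the sum from the interior; scaling within the cone makes the functional
nonpositive there. Its negative vanishes on the sum, hence on each summand. -/
theorem exists_supporting_form (hrank : (A.map (Int.cast : ℤ → ℝ)).rank = d)
    {σ : Finset (Fin n)} (hσ : ∑ i ∈ σ, toEuclidean (A.col i) ∉ interior (cone A)) :
    ∃ c : EuclideanSpace ℝ (Fin d), c ≠ 0 ∧ (∀ i, 0 ≤ inner ℝ c (toEuclidean (A.col i))) ∧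
      ∀ i ∈ σ, inner ℝ c (toEuclidean (A.col i)) = 0 := by
  obtain ⟨f, hf⟩ := geometric_hahn_banach_open_point (convex_cone A).interior isOpen_interior hσ
  set x := ∑ i ∈ σ, toEuclidean (A.col i)
  have hle : ∀ y ∈ cone A, f y ≤ f x := by
    intro y hy
    have hy' : y ∈ closure (interior (cone A)) := by
      rw [(convex_cone A).closure_interior_eq_closure_of_nonempty_interior
        (interior_cone_nonempty hrank)]
      exact subset_closure hy
    exact closure_minimal (fun z hz => (hf z hz).le)
      (isClosed_le f.continuous continuous_const) hy'
  have hx0 : 0 ≤ f x := by simpa using hle 0 (zero_mem_cone A)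
  have hnonpos : ∀ y ∈ cone A, f y ≤ 0 := by
    intro y hy
    by_contra! hpos
    have := hle _ (smul_mem_cone hy (t := (f x + 1) / f y) (by positivity))
    rw [map_smul, smul_eq_mul, div_mul_cancel₀ _ hpos.ne'] at this
    linarith
  obtain ⟨c, hc⟩ : ∃ c : EuclideanSpace ℝ (Fin d), ∀ y, inner ℝ c y = - f y :=
    ⟨(InnerProductSpace.toDual ℝ _).symm (-f), fun y => by simp⟩
  have hca : ∀ i, 0 ≤ inner ℝ c (toEuclidean (A.col i)) := fun i => by
    rw [hc]; linarith [hnonpos _ (toEuclidean_col_mem_cone A i)]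
  refine ⟨c, ?_, hca, ?_⟩
  · rintro rfl
    obtain ⟨y, hy⟩ := interior_cone_nonempty hrank
    have h1 := hc y
    have h2 := hc x
    rw [inner_zero_left] at h1 h2
    linarith [hf y hy]
  · have hsum : ∑ i ∈ σ, inner ℝ c (toEuclidean (A.col i)) = 0 := by
      refine le_antisymm ?_ (Finset.sum_nonneg fun i _ => hca i)
      rw [← inner_sum, hc]
      linarith
    exact (Finset.sum_eq_zero_iff_of_nonneg fun i _ => hca i).1 hsum

/-- Tilting a supporting form along a direction that vanishes on its face enlarges the face. -/
theorem exists_larger_face {c c' : EuclideanSpace ℝ (Fin d)} (hc0 : c ≠ 0)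
    (hc : ∀ i, 0 ≤ inner ℝ c (toEuclidean (A.col i))) (hcc' : inner ℝ c c' = 0)
    (hface : ∀ x ∈ cone A, inner ℝ c x = 0 → inner ℝ c' x = 0)
    (hneg : ∃ i, inner ℝ c' (toEuclidean (A.col i)) < 0) :
    ∃ c₁ : EuclideanSpace ℝ (Fin d), c₁ ≠ 0 ∧ (∀ i, 0 ≤ inner ℝ c₁ (toEuclidean (A.col i))) ∧
      (∀ x ∈ cone A, inner ℝ c x = 0 → inner ℝ c₁ x = 0) ∧
      ∃ i, inner ℝ c₁ (toEuclidean (A.col i)) = 0 ∧ inner ℝ c' (toEuclidean (A.col i)) ≠ 0 := by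
  classical
  -- The minimal ratio is the largest tilt `t` keeping `c + t • c'` nonnegative on all columns; it
  -- vanishes on the minimizing column.
  obtain ⟨i₀, hi₀, hmin⟩ := Finset.exists_min_image
    (Finset.univ.filter fun i => inner ℝ c' (toEuclidean (A.col i)) < 0)
    (fun i => inner ℝ c (toEuclidean (A.col i)) / -inner ℝ c' (toEuclidean (A.col i)))
    (by obtain ⟨i, hi⟩ := hneg; exact ⟨i, by simpa using hi⟩)
  simp only [Finset.mem_filter, Finset.mem_univ, true_and] at hi₀ hmin
  set t := inner ℝ c (toEuclidean (A.col i₀)) / -inner ℝ c' (toEuclidean (A.col i₀)) with ht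
  have ht0 : 0 ≤ t := div_nonneg (hc i₀) (by linarith)
  have hform : ∀ x, inner ℝ (c + t • c') x = inner ℝ c x + t * inner ℝ c' x := fun x => by
    rw [inner_add_left, real_inner_smul_left]
  refine ⟨c + t • c', fun h => ?_, fun i => ?_, fun x hx h => ?_, i₀, ?_, hi₀.ne⟩
  · have h1 := hform c
    rw [h, inner_zero_left, real_inner_comm c c', hcc', mul_zero, add_zero] at h1
    exact hc0 (inner_self_eq_zero.1 h1.symm)
  · rw [hform]
    rcases lt_or_ge (inner ℝ c' (toEuclidean (A.col i))) 0 with h | h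
    · have := hmin i h
      rw [le_div_iff₀ (by linarith)] at this
      linarith
    · have := hc i
      positivity
  · rw [hform, h, hface x hx h, mul_zero, add_zero]
  · rw [hform, ht]
    have := hi₀.ne
    field_simp
    ring

/-- Take a supporting form vanishing on `σ` whose face has maximal dimension. If that dimension is
below `d - 1`, some nonzero `c'` is orthogonal to both the face and `c`; since the columns span,
`c'` or `-c'` is negative on one of them, and tilting yields a larger face. -/
theorem exists_facet (hrank : (A.map (Int.cast : ℤ → ℝ)).rank = d) {σ : Finset (Fin n)}
    (hσ : ∑ i ∈ σ, toEuclidean (A.col i) ∉ interior (cone A)) :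
    ∃ F, IsFacet A F ∧ ∀ i ∈ σ, toEuclidean (A.col i) ∈ F := by
  let F : EuclideanSpace ℝ (Fin d) → Set (EuclideanSpace ℝ (Fin d)) := fun c =>
    {x ∈ cone A | inner ℝ c x = 0}
  let P : Set (EuclideanSpace ℝ (Fin d)) := {c | c ≠ 0 ∧
    (∀ i, 0 ≤ inner ℝ c (toEuclidean (A.col i))) ∧
    ∀ i ∈ σ, inner ℝ c (toEuclidean (A.col i)) = 0}
  obtain ⟨c, ⟨hc0, hc, hcσ⟩, hmax⟩ := (measure fun c =>
    d - Module.finrank ℝ (Submodule.span ℝ (F c))).wf.has_min P (exists_supporting_form hrank hσ)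
  have hfin : Module.finrank ℝ (EuclideanSpace ℝ (Fin d)) = d := by simp
  refine ⟨F c, ⟨⟨c, fun x hx => inner_nonneg_of_mem_cone hc hx, rfl⟩, le_antisymm ?_ ?_⟩,
    fun i hi => ⟨toEuclidean_col_mem_cone A i, hcσ i hi⟩⟩
  · have h1 : Submodule.span ℝ (F c) ≤ (Submodule.span ℝ {c})ᗮ :=
      Submodule.span_le.2 fun x hx => Submodule.mem_orthogonal_singleton_iff_inner_right.2 hx.2
    have h2 := Submodule.finrank_mono h1
    have h3 := Submodule.finrank_add_finrank_orthogonal (Submodule.span ℝ {c})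
    rw [finrank_span_singleton hc0, hfin] at h3
    omega
  · by_contra! hlt
    set W := Submodule.span ℝ (F c) ⊔ Submodule.span ℝ {c}
    have hW : Module.finrank ℝ W < d := by
      have := Submodule.finrank_add_le_finrank_add_finrank (Submodule.span ℝ (F c))
        (Submodule.span ℝ {c})
      rw [finrank_span_singleton hc0] at this
      exact this.trans_lt hlt
    have hbot : Wᗮ ≠ ⊥ := fun h => by
      have := Submodule.finrank_add_finrank_orthogonal W
      rw [h, finrank_bot, hfin] at this
      omega
    obtain ⟨c', hc', hc'0⟩ := Submodule.exists_mem_ne_zero_of_ne_bot hbot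
    have key : ∀ c' ∈ Wᗮ, ¬ ∃ i, inner ℝ c' (toEuclidean (A.col i)) < 0 := by
      intro c' hc' hneg
      have hface : ∀ x ∈ Submodule.span ℝ (F c), inner ℝ c' x = 0 := fun x hx => by
        rw [real_inner_comm]
        exact hc' x (Submodule.mem_sup_left hx)
      obtain ⟨c₁, h0, hnn, hsub, i, hi, hi'⟩ := exists_larger_face hc0 hc
        (hc' c (Submodule.mem_sup_right (Submodule.mem_span_singleton_self c)))
        (fun x hx h => hface x (Submodule.subset_span ⟨hx, h⟩)) hneg
      have hss : Submodule.span ℝ (F c) < Submodule.span ℝ (F c₁) := by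
        refine lt_of_le_of_ne (Submodule.span_mono fun x hx => ⟨hx.1, hsub x hx.1 hx.2⟩)
          fun h => hi' (hface _ ?_)
        rw [h]
        exact Submodule.subset_span ⟨toEuclidean_col_mem_cone A i, hi⟩
      refine hmax c₁ ⟨h0, hnn, fun i hi => hsub _ (toEuclidean_col_mem_cone A i) (hcσ i hi)⟩ ?_
      have h1 := Submodule.finrank_lt_finrank_of_lt hss
      have h2 := Submodule.finrank_le (Submodule.span ℝ (F c₁))
      rw [hfin] at h2
      change d - _ < d - _
      omega
    have hzero : ∀ i, inner ℝ c' (toEuclidean (A.col i)) = 0 := fun i => by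
      refine le_antisymm ?_ (not_lt.1 fun h => key c' hc' ⟨i, h⟩)
      refine not_lt.1 fun h => key (-c') (neg_mem hc') ⟨i, ?_⟩
      rw [inner_neg_left]
      linarith
    obtain ⟨l, hl⟩ := exists_eq_sum_smul hrank c'
    apply hc'0
    rw [← inner_self_eq_zero (𝕜 := ℝ)]
    nth_rewrite 2 [← hl]
    rw [inner_sum]
    exact Finset.sum_eq_zero fun i _ => by rw [inner_smul_right, hzero, mul_zero]

/-! ### Standard pairs -/

/-- Initial forms commute with multiplication by monomials, so a power of `x^σ` carries each element
of the toric initial ideal into the circuit one. -/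
theorem Covers.exists_monomial_mem_initialIdeal
    (hgen : ∀ z ∈ lattice A, z ∈ AddSubgroup.closure {c | IsCircuit A c})
    {σ : Finset (Fin n)} (hσ : Covers k A σ) {ω : Fin n → ℝ} {e : Fin n →₀ ℕ}
    (he : monomial e (1 : k) ∈ initialIdeal ω (toricIdeal k A)) :
    ∃ N : ℕ, monomial (e + N • ind σ) (1 : k) ∈ initialIdeal ω (circuitIdeal k A) := by
  have hG : ∀ g ∈ initialForm ω '' (toricIdeal k A : Set (MvPolynomial (Fin n) k)),
      ∃ N : ℕ, monomial (N • ind σ) 1 * g ∈ initialIdeal ω (circuitIdeal k A) := by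
    rintro _ ⟨f, hf, rfl⟩
    obtain ⟨N, hN⟩ := hσ.exists_mul_mem hgen hf
    exact ⟨N, by rw [← initialForm_monomial_mul]; exact initialForm_mem hN⟩
  obtain ⟨N, hN⟩ := exists_monomial_mul_mem_of_mem_span hG he
  refine ⟨N, ?_⟩
  rwa [monomial_mul, one_mul, add_comm] at hN

/-- Since `σ ⊆ τ`, the extra factor `x^(Nσ)` is absorbed into the free directions of the pair. -/
theorem Covers.isAdmissiblePair_iff
    (hgen : ∀ z ∈ lattice A, z ∈ AddSubgroup.closure {c | IsCircuit A c})
    {σ : Finset (Fin n)} (hσ : Covers k A σ) {ω : Fin n → ℝ} {v : Fin n →₀ ℕ}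
    {τ : Finset (Fin n)} (hτ : σ ⊆ τ) :
    IsAdmissiblePair (initialIdeal ω (circuitIdeal k A)) v τ ↔
      IsAdmissiblePair (initialIdeal ω (toricIdeal k A)) v τ := by
  refine and_congr_right fun _ => ⟨fun h m hm hmem => ?_, fun h m hm hmem => ?_⟩
  · obtain ⟨N, hN⟩ := hσ.exists_monomial_mem_initialIdeal hgen hmem
    rw [add_assoc] at hN
    refine h (m + N • ind σ) (fun i hi => ?_) hN
    by_contra hiτ
    have h1 : m i = 0 := Finsupp.notMem_support_iff.1 fun h => hiτ (hm h)
    have h2 : i ∉ σ := fun h => hiτ (hτ h)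
    simp [h1, h2] at hi
  · exact h m hm (initialIdeal_mono circuitIdeal_le_toricIdeal hmem)

theorem Covers.isStandardPair_iff
    (hgen : ∀ z ∈ lattice A, z ∈ AddSubgroup.closure {c | IsCircuit A c})
    {σ : Finset (Fin n)} (hσ : Covers k A σ) {ω : Fin n → ℝ} {u : Fin n →₀ ℕ} :
    IsStandardPair (initialIdeal ω (circuitIdeal k A)) u σ ↔
      IsStandardPair (initialIdeal ω (toricIdeal k A)) u σ := by
  refine and_congr (hσ.isAdmissiblePair_iff hgen subset_rfl) (not_congr ?_)
  refine exists_congr fun v => exists_congr fun τ => and_congr_right fun _ => ?_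
  constructor
  · rintro ⟨h, hvu, hτ⟩
    exact ⟨(hσ.isAdmissiblePair_iff hgen (Finset.union_subset_right hτ)).1 h, hvu, hτ⟩
  · rintro ⟨h, hvu, hτ⟩
    exact ⟨(hσ.isAdmissiblePair_iff hgen (Finset.union_subset_right hτ)).2 h, hvu, hτ⟩

theorem IsCSP.exists_facet (hrank : (A.map (Int.cast : ℤ → ℝ)).rank = d) {ω : Fin n → ℝ}
    {u : Fin n →₀ ℕ} {σ : Finset (Fin n)} (h : IsCSP k A ω u σ) :
    ∃ F, IsFacet A F ∧ ∀ i ∈ σ, toEuclidean (A.col i) ∈ F := by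
  classical
  refine CircuitIdeal.exists_facet hrank fun hint => h.2 ?_
  have hσ : Covers k A σ := by
    refine covers_of_mem_interior (μ := fun i => if i ∈ σ then 1 else 0)
      (fun j hj => if_neg hj) ?_
    simpa [ite_smul] using hint
  exact (hσ.isStandardPair_iff fun _ => mem_closure_circuits hrank).1 h.1

/-! ### Degrees deep in the interior of the cone -/

theorem toEuclidean_degMap (u : Fin n →₀ ℕ) :
    toEuclidean (degMap A u) = ∑ i, (u i : ℝ) • toEuclidean (A.col i) := by
  ext r
  rw [sum_smul_toEuclidean_apply, degMap_apply]
  simp [toEuclidean, Matrix.mulVec, dotProduct]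

/-- If `A u` is far from the boundary of the cone, the columns with large coefficients in `u`
meet its interior. -/
theorem covers_of_frontier_dist {T : ℕ} {u : Fin n →₀ ℕ}
    (hu : ∀ y ∈ frontier (cone A), 1 + ∑ i, T * ‖toEuclidean (A.col i)‖ ≤
      dist (toEuclidean (degMap A u)) y) :
    Covers k A (Finset.univ.filter fun i => T ≤ u i) := by
  classical
  set μ : Fin n → ℝ := fun i => if T ≤ u i then (u i : ℝ) else 0
  refine covers_of_mem_interior (μ := μ) (fun j hj => if_neg (by simpa using hj)) ?_
  by_contra hint
  have hmem : ∑ j, μ j • toEuclidean (A.col j) ∈ cone A := by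
    refine ⟨μ, fun i => ?_, rfl⟩
    simp only [μ]
    split_ifs <;> positivity
  -- A cone point outside the interior is on the frontier, yet it is within `∑ T‖a_i‖` of `A u`; the
  -- extra `1` makes this a contradiction.
  have h := hu _ ⟨subset_closure hmem, hint⟩
  rw [toEuclidean_degMap, dist_eq_norm, ← Finset.sum_sub_distrib] at h
  have hle : ‖∑ i, ((u i : ℝ) • toEuclidean (A.col i) - μ i • toEuclidean (A.col i))‖ ≤
      ∑ i, T * ‖toEuclidean (A.col i)‖ := by
    refine norm_sum_le_of_le _ fun i _ => ?_
    rw [← sub_smul, norm_smul]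
    refine mul_le_mul_of_nonneg_right ?_ (norm_nonneg _)
    simp only [μ]
    split_ifs with hi
    · simp
    · simp only [sub_zero, Real.norm_natCast, Nat.cast_le]
      omega
  linarith

theorem exists_radius_forall_cong (k : Type*) [Field k]
    (hrank : (A.map (Int.cast : ℤ → ℝ)).rank = d) :
    ∃ R : ℝ, ∀ b : Fin d → ℤ, (∀ y ∈ frontier (cone A), R ≤ dist (toEuclidean b) y) →
      ∀ u ∈ fiber A b, ∀ v ∈ fiber A b, binomial k u v ∈ circuitIdeal k A := by
  classical
  have hgen : ∀ z ∈ lattice A, z ∈ AddSubgroup.closure {c | IsCircuit A c} :=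
    fun _ => mem_closure_circuits hrank
  obtain ⟨N, hN⟩ := exists_forall_cong k hgen
  have hcov : ∀ σ : Finset (Fin n), ∃ M : ℕ, Covers k A σ → ∃ p : Fin n →₀ ℕ,
      (∀ i, 1 ≤ p i) ∧ binomial k (M • ind σ) p ∈ circuitIdeal k A := fun σ => by
    by_cases hσ : Covers k A σ
    · obtain ⟨M, hM⟩ := hσ
      exact ⟨M, fun _ => hM⟩
    · exact ⟨0, fun h => absurd h hσ⟩
  choose M hM using hcov
  -- Summing over the finitely many `σ` gives one threshold: coordinates at least `T` leave room for
  -- `N` copies of `M σ • ind σ`, whose replacement `N • p` is at least `N` everywhere.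
  set T := N * ∑ σ, M σ
  refine ⟨1 + ∑ i, T * ‖toEuclidean (A.col i)‖, fun b hb => ?_⟩
  have hfull : ∀ u ∈ fiber A b, ∃ u', (∀ i, N ≤ u' i) ∧ binomial k u u' ∈ circuitIdeal k A := by
    intro u hu
    have hu' : degMap A u = b := hu
    have hσ : Covers k A (Finset.univ.filter fun i => T ≤ u i) :=
      covers_of_frontier_dist (by rwa [hu'])
    set σ := Finset.univ.filter fun i => T ≤ u i with hσdef
    obtain ⟨p, hp, hMp⟩ := hM σ hσ
    have hT : N * M σ ≤ T :=
      Nat.mul_le_mul_left _ (Finset.single_le_sum (f := M) (by simp) (Finset.mem_univ σ))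
    obtain ⟨r, hr⟩ : ∃ r, u = N • (M σ • ind σ) + r := by
      refine exists_add_of_le fun i => ?_
      by_cases hi : i ∈ σ
      · have : T ≤ u i := by simpa [hσdef] using hi
        simpa [hi] using hT.trans this
      · simp [hi]
    refine ⟨N • p + r, fun i => ?_, hr ▸ cong_add_right r (cong_nsmul N hMp)⟩
    have := Nat.mul_le_mul_left N (hp i)
    simp only [Finsupp.add_apply, Finsupp.smul_apply, smul_eq_mul]
    omega
  intro u hu v hv
  obtain ⟨u', hu', huu'⟩ := hfull u hu
  obtain ⟨v', hv', hvv'⟩ := hfull v hv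
  refine cong_trans (cong_trans huu' (hN u' v' hu' hv' ?_)) (cong_symm hvv')
  rw [← degMap_eq_of_mem_circuitIdeal huu', ← degMap_eq_of_mem_circuitIdeal hvv']
  exact Eq.trans hu (Eq.symm hv)

end CircuitIdeal

theorem theorem3p11 {k : Type*} [Field k] [IsAlgClosed k] {d n : ℕ}
    (A : Matrix (Fin d) (Fin n) ℤ)
    (hrank : (A.map (Int.cast : ℤ → ℝ)).rank = d)
    (hpointed : ∀ u : Fin n → ℤ, u ∈ CircuitIdeal.lattice A → (∀ i, 0 ≤ u i) → u = 0) :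
    (∃ R : ℝ, ∀ b ∈ CircuitIdeal.semigroup A,
      (∀ y ∈ frontier (CircuitIdeal.cone A), R ≤ dist (CircuitIdeal.toEuclidean b) y) →
        CircuitIdeal.hilbertFunction A (CircuitIdeal.circuitIdeal k A) b = 1 ∧
        (∀ G : Set (MvPolynomial (Fin n) k),
          CircuitIdeal.IsBinomialGeneratingSet G (CircuitIdeal.circuitIdeal k A) →
            (CircuitIdeal.fiberGraph A G b).Connected) ∧
        (∀ ω : Fin n → ℝ, CircuitIdeal.IsGeneric k A ω →
          (CircuitIdeal.fiberDigraph A ω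
            (CircuitIdeal.circuitIdeal k A) b).toSimpleGraphInclusive.Connected)) ∧
    (∀ ω : Fin n → ℝ, CircuitIdeal.IsGeneric k A ω →
      ∀ (u : Fin n →₀ ℕ) (σ : Finset (Fin n)), CircuitIdeal.IsCSP k A ω u σ →
        ∃ F, CircuitIdeal.IsFacet A F ∧
          ∀ i ∈ σ, CircuitIdeal.toEuclidean (A.col i) ∈ F) := by
  obtain ⟨R, hR⟩ := CircuitIdeal.exists_radius_forall_cong k hrank
  refine ⟨⟨R, fun b hb hdist => ?_⟩, fun ω _ u σ h => h.exists_facet hrank⟩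
  have hcong := hR b hdist
  -- Membership of `b` in the semigroup is by definition nonemptiness of its fiber, so `hb` serves
  -- as the latter.
  exact ⟨CircuitIdeal.hilbertFunction_eq_one hb hcong,
    fun G hG => CircuitIdeal.fiberGraph_connected hG hb hcong,
    fun ω hω => CircuitIdeal.fiberDigraph_connected hpointed hω.2 hb hcong⟩
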